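/- Let $X, D$ be Banach spaces with a dense, compact, injective embedding $D\hookrightarrow X$, let $1<p<\infty$, and let $\mathcal L(D;X)$ be the space of bounded linear operators. For an open interval $J=(\alpha,\beta)$, $-\infty<\alpha<\beta\le+\infty$, let $\mathrm{MR}^p(J)=L^p(J;D)\cap W^{1,p}(J;X)$, with norm $$\|u\|_{\mathrm{MR}^p(J)}=\Big(\|u\|_{L^p(J;X)}^p+\|u\|_{L^p(J;D)}^p+w_J^p\,\|u'\|_{L^p(J;X)}^p\Big)^{1/p},$$ where $w_J=|J|$ if $\beta<\infty$ and $w_J=1$ if $\beta=\infty$. A map $A:t\mapsto A(t)\in\mathcal L(D;X)$ is called *maximally regular on $J$*, $A\in\mathcal{MR}_p(J)$, if it lies in $L^\infty(J;\mathcal L(D;X))$ (i.e. for every $x\in D$, $A(\cdot)x$ is Bochner measurable and essentially bounded; maps are identified when they agree almost everywhere), the graph norm $\|x\|_X+\|A(t)x\|_X$ is equivalent to $\|x\|_D$ for almost every $t\in J$, and there is $K\ge0$ such that for every $f\in L^p(J;X)$ the problem $$v'(t)+A(t)v(t)=f(t)\ \text{ for a.e. } t\in J,\qquad v(\alpha)=0,$$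 has a unique solution $v\in\mathrm{MR}^p(J)$, and $\|v\|_{\mathrm{MR}^p(J)}\le K\|f\|_{L^p(J;X)}$. For a time-independent $A\in\mathcal L(D;X)$ one writes $A\in mr_p(J)$, and $[A]_{mr_p(J)}$ denotes the infimum of the constants $K$ admissible in the inequality. Let $I=(a,b)$ be a bounded open interval. A map $A:\overline I\to\mathcal L(D;X)$ is *relatively continuous*, $A\in RC(I)$, if $A(\cdot)x$ is Bochner measurable for each $x\in D$ and for every $\epsilon>0$ there are $\delta>0$, $\eta\ge0$ such that $\|A(t)x-A(s)x\|_X\le\epsilon\|x\|_D+\eta\|x\|_X$ for all $x\in D$ and all $t,s\in\overline I$ with $|t-s|\le\delta$. Let $\Lambda$ be a metric space, $\mathcal O\subset\Lambda$ open, $\overline\lambda\in\overline{\mathcal O}$, and let $A_\lambda:\overline I\to\mathcal L(D;X)$ for $\lambda\in\Lambda$. Assume that 1. $A_\lambda\in RC(I)$ for every $\lambda\in\mathcal O$; 2. for every $t\in\overline I$: $A_\lambda(t)\in mr_p((0,\infty))$ for all $\lambda\in\mathcal O$, and $\sup_{\lambda\in\mathcal O}[A_\lambda(t)]_{mr_p(I)}<\infty$;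 3. $\|A_\lambda-A_{\overline\lambda}\|_\infty:=\operatorname{ess\,sup}_{t\in I}\|A_\lambda(t)-A_{\overline\lambda}(t)\|_{\mathcal L(D;X)}\to0$ as $\lambda\to\overline\lambda$, $\lambda\in\mathcal O$. Then $A_\lambda\in\mathcal{MR}_p(I)$ for every $\lambda\in\mathcal O$, and $A_{\overline\lambda}\in\mathcal{MR}_p(I)$; moreover the graph norm of $A_{\overline\lambda}(t)$ is equivalent to $\|\cdot\|_D$ at every $t\in\overline I$ for which $A_\lambda(t)\to A_{\overline\lambda}(t)$ in $\mathcal L(D;X)$ as $\lambda\to\overline\lambda$ in $\mathcal O$. Furthermore, let $f_\lambda\in L^p(I;X)$ for $\lambda \in \Lambda$, and let $v_\lambda\in\mathrm{MR}^p(I)$ be the solution of $v_\lambda'+A_\lambda v_\lambda=f_\lambda$, $v_\lambda(a)=0$, for $\lambda\in\mathcal O\cup\{\overline\lambda\}$. If $f_\lambda\rightharpoonup f_{\overline\lambda}$ weakly in $L^p(I;X)$ as $\lambda\to\overline\lambda$ in $\mathcal O$, then $v_\lambda\rightharpoonup v_{\overline\lambda}$ weakly in $\mathrm{MR}^p(I)$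 as $\lambda\to\overline\lambda$ in $\mathcal O$. -/

import Mathlib

open MeasureTheory Filter Topology Set
open scoped ENNReal NNReal ContDiff

namespace MaxReg

noncomputable section

/-- The open time interval `(a, b)`, bounded from below, with `b = ⊤` allowed. -/
def timeInterval (a : ℝ) (b : EReal) : Set ℝ := {t | a < t ∧ (t : EReal) < b}

/-- Lebesgue measure on `(a, b)`. -/
abbrev timeMeasure (a : ℝ) (b : EReal) : Measure ℝ := volume.restrict (timeInterval a b)

/-- The weight of the derivative in the norm of the maximal regularity space:
the length `b - a` of a bounded interval, and `1` if `b = ⊤`. -/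
def derivWeight (a : ℝ) (b : EReal) : ℝ := if b = ⊤ then 1 else b.toReal - a

/-- Test functions: smooth, compactly supported inside `(a, b)`. -/
def IsTest (a : ℝ) (b : EReal) (φ : ℝ → ℝ) : Prop :=
  ContDiff ℝ ∞ φ ∧ HasCompactSupport φ ∧ tsupport φ ⊆ timeInterval a b

/-- `w` is the weak derivative of `u` on `(a, b)`. -/
def IsWeakDeriv {X : Type*} [NormedAddCommGroup X] [NormedSpace ℝ X] (a : ℝ) (b : EReal)
    (u w : ℝ → X) : Prop :=
  ∀ φ : ℝ → ℝ, IsTest a b φ →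
    -∫ t in timeInterval a b, deriv φ t • u t = ∫ t in timeInterval a b, φ t • w t

theorem integrable_smul_lp {X : Type*} [NormedAddCommGroup X] [NormedSpace ℝ X]
    {p : ℝ≥0∞} (hp : 1 ≤ p) {μ : Measure ℝ} [IsLocallyFiniteMeasure μ] {u : ℝ → X}
    (hu : MemLp u p μ) {ψ : ℝ → ℝ} (hψ : Continuous ψ) (hc : HasCompactSupport ψ) :
    Integrable (fun t => ψ t • u t) μ :=
  (hu.locallyIntegrable hp).integrable_smul_left_of_hasCompactSupport hψ hc

section Spaces

variable {X D : Type*} [NormedAddCommGroup X] [NormedSpace ℝ X]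
  [NormedAddCommGroup D] [NormedSpace ℝ D]

/-- The maximal regularity space `L^p(a,b;D) ∩ W^{1,p}(a,b;X)`, where `D` is seen in `X` through
the injection `j`.  An element `u` is stored together with its weak derivative `u'`, as the pair
`(u, u')`; the second component is determined by the first. -/
def MRSpace (p : ℝ≥0∞) [Fact (1 ≤ p)] (j : D →L[ℝ] X) (a : ℝ) (b : EReal) :
    Submodule ℝ (Lp D p (timeMeasure a b) × Lp X p (timeMeasure a b)) where
  carrier := {z | IsWeakDeriv a b (fun t => j (z.1 t)) (fun t => z.2 t)}
  zero_mem' := by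
    intro φ _
    have h1 : (fun t => deriv φ t • j ((0 : Lp D p (timeMeasure a b)) t))
        =ᵐ[timeMeasure a b] fun _ => (0 : X) := by
      filter_upwards [Lp.coeFn_zero D p (timeMeasure a b)] with t ht
      rw [ht, Pi.zero_apply, map_zero, smul_zero]
    have h2 : (fun t => φ t • (0 : Lp X p (timeMeasure a b)) t)
        =ᵐ[timeMeasure a b] fun _ => (0 : X) := by
      filter_upwards [Lp.coeFn_zero X p (timeMeasure a b)] with t ht
      rw [ht, Pi.zero_apply, smul_zero]
    change -∫ t in timeInterval a b, deriv φ t • j ((0 : Lp D p (timeMeasure a b)) t)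
      = ∫ t in timeInterval a b, φ t • (0 : Lp X p (timeMeasure a b)) t
    rw [integral_congr_ae h1, integral_congr_ae h2]
    simp
  add_mem' := by
    rintro ⟨u, u'⟩ ⟨v, v'⟩ hu hv φ hφ
    have hp : 1 ≤ p := Fact.out
    have hd : Continuous (deriv φ) := hφ.1.continuous_deriv (by simp)
    have hdc : HasCompactSupport (deriv φ) := hφ.2.1.deriv
    have iu := integrable_smul_lp hp (j.comp_memLp' (Lp.memLp u)) hd hdc
    have iv := integrable_smul_lp hp (j.comp_memLp' (Lp.memLp v)) hd hdc
    have iu' := integrable_smul_lp hp (Lp.memLp u') hφ.1.continuous hφ.2.1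
    have iv' := integrable_smul_lp hp (Lp.memLp v') hφ.1.continuous hφ.2.1
    have h1 : (fun t => deriv φ t • j ((u + v) t)) =ᵐ[timeMeasure a b]
        fun t => deriv φ t • j (u t) + deriv φ t • j (v t) := by
      filter_upwards [Lp.coeFn_add u v] with t ht
      rw [ht, Pi.add_apply, map_add, smul_add]
    have h2 : (fun t => φ t • (u' + v') t) =ᵐ[timeMeasure a b]
        fun t => φ t • u' t + φ t • v' t := by
      filter_upwards [Lp.coeFn_add u' v'] with t ht
      rw [ht, Pi.add_apply, smul_add]
    change -∫ t in timeInterval a b, deriv φ t • j ((u + v) t)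
      = ∫ t in timeInterval a b, φ t • (u' + v') t
    have e1 := integral_add iu iv
    have e2 := integral_add iu' iv'
    have hu' := hu φ hφ
    have hv' := hv φ hφ
    simp only [Function.comp_def] at e1
    rw [integral_congr_ae h1, integral_congr_ae h2, e1, e2, neg_add]
    exact congrArg₂ _ hu' hv'
  smul_mem' := by
    rintro c ⟨u, u'⟩ hu φ hφ
    have h1 : (fun t => deriv φ t • j ((c • u) t)) =ᵐ[timeMeasure a b]
        fun t => c • (deriv φ t • j (u t)) := by
      filter_upwards [Lp.coeFn_smul c u] with t ht
      simp [ht, smul_comm c]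
    have h2 : (fun t => φ t • (c • u') t) =ᵐ[timeMeasure a b]
        fun t => c • (φ t • u' t) := by
      filter_upwards [Lp.coeFn_smul c u'] with t ht
      simp [ht, smul_comm c]
    change -∫ t in timeInterval a b, deriv φ t • j ((c • u) t)
      = ∫ t in timeInterval a b, φ t • (c • u') t
    have hu' := hu φ hφ
    rw [integral_congr_ae h1, integral_congr_ae h2, integral_smul, integral_smul, ← smul_neg]
    exact congrArg _ hu'

variable (p : ℝ≥0∞) [Fact (1 ≤ p)] (j : D →L[ℝ] X) (a : ℝ) (b : EReal)

/-- The norm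
`(‖u‖_{L^p(I;X)}^p + ‖u‖_{L^p(I;D)}^p + w^p ‖u'‖_{L^p(I;X)}^p)^{1/p}`, `w = derivWeight a b`. -/
def mrNorm (u : MRSpace p j a b) : ℝ :=
  (‖j.compLp u.1.1‖ ^ p.toReal + ‖u.1.1‖ ^ p.toReal
    + derivWeight a b ^ p.toReal * ‖u.1.2‖ ^ p.toReal) ^ (1 / p.toReal)

/-- `u(a) = 0`: the continuous representative of `u` on the closed interval, with values in `X`,
vanishes at the left end point. -/
def ZeroAtLeft (u : MRSpace p j a b) : Prop :=
  ∃ c : ℝ → X, ContinuousOn c (closure (timeInterval a b)) ∧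
    (∀ᵐ t ∂(timeMeasure a b), c t = j (u.1.1 t)) ∧ c a = 0

/-- `v` solves `v' + A(t) v = f` almost everywhere on `(a, b)`, `v(a) = 0`. -/
def IsSolution (A : ℝ → D →L[ℝ] X) (f : Lp X p (timeMeasure a b)) (v : MRSpace p j a b) : Prop :=
  (∀ᵐ t ∂(timeMeasure a b), v.1.2 t + A t (v.1.1 t) = f t) ∧ ZeroAtLeft p j a b v

/-- `K` is an admissible constant in the maximal regularity inequality. -/
def IsMRBound (A : ℝ → D →L[ℝ] X) (K : ℝ≥0) : Prop :=
  ∀ (f : Lp X p (timeMeasure a b)) (v : MRSpace p j a b),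
    IsSolution p j a b A f v → mrNorm p j a b v ≤ K * ‖f‖

/-- Unique solvability in the maximal regularity space for every source term in `L^p`, with the
maximal regularity inequality. -/
def WellPosed (A : ℝ → D →L[ℝ] X) : Prop :=
  (∀ f : Lp X p (timeMeasure a b), ∃! v : MRSpace p j a b, IsSolution p j a b A f v) ∧
    ∃ K : ℝ≥0, IsMRBound p j a b A K

/-- The maximal regularity constant: the infimum of the admissible constants. -/
def mrConst (A : ℝ → D →L[ℝ] X) : ℝ≥0∞ :=
  ⨅ (K : ℝ≥0) (_ : IsMRBound p j a b A K), (K : ℝ≥0∞)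

/-- The graph norm `‖x‖_X + ‖A x‖_X` of `A` is equivalent to the norm of `D`. -/
def GraphNormEquiv (A : D →L[ℝ] X) : Prop :=
  ∃ c C : ℝ, 0 < c ∧ 0 < C ∧ ∀ x : D, c * ‖x‖ ≤ ‖j x‖ + ‖A x‖ ∧ ‖j x‖ + ‖A x‖ ≤ C * ‖x‖

/-- The autonomous operator `A` has the `L^p` maximal regularity property on `(a, b)`. -/
def IsMaxRegAut (A : D →L[ℝ] X) : Prop :=
  GraphNormEquiv j A ∧ WellPosed p j a b (fun _ => A)

/-- `A` belongs to `L^∞(a,b; L(D;X))`: for each `x`, the map `t ↦ A(t) x` is Bochner measurable and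
essentially bounded. -/
def MemLInfty (A : ℝ → D →L[ℝ] X) : Prop :=
  ∀ x : D, MemLp (fun t => A t x) ⊤ (timeMeasure a b)

/-- The nonautonomous operator `A` has the `L^p` maximal regularity property on `(a, b)`.  Elements
of `L^∞(a,b; L(D;X))` are identified when they agree almost everywhere, so that the equivalence of
norms is asked for almost every `t`. -/
def IsMaxReg (A : ℝ → D →L[ℝ] X) : Prop :=
  MemLInfty a b A ∧ (∀ᵐ t ∂(timeMeasure a b), GraphNormEquiv j (A t)) ∧ WellPosed p j a b A

/-- The distance `‖A - B‖_∞`: the essential supremum over `(a, b)` of the operator norm of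
`A(t) - B(t)`. -/
def distInfty (A B : ℝ → D →L[ℝ] X) : ℝ≥0∞ :=
  essSup (fun t => ‖A t - B t‖ₑ) (timeMeasure a b)

/-- Relative continuity on the closed interval `[a, b]`. -/
def RelCont (a b : ℝ) (A : ℝ → D →L[ℝ] X) : Prop :=
  (∀ x : D, AEStronglyMeasurable (fun t => A t x) (timeMeasure a b)) ∧
    ∀ ε : ℝ, 0 < ε → ∃ δ η : ℝ, 0 < δ ∧ 0 ≤ η ∧
      ∀ x : D, ∀ t ∈ Icc a b, ∀ s ∈ Icc a b, |t - s| ≤ δ →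
        ‖A t x - A s x‖ ≤ ε * ‖x‖ + η * ‖j x‖

/-- Weak convergence in `L^p(a,b;X)` along a filter. -/
def WeakTendstoLp {ι : Type*} (f : ι → Lp X p (timeMeasure a b)) (l : Filter ι)
    (g : Lp X p (timeMeasure a b)) : Prop :=
  ∀ φ : Lp X p (timeMeasure a b) →L[ℝ] ℝ, Tendsto (fun i => φ (f i)) l (𝓝 (φ g))

/-- Weak convergence in the maximal regularity space along a filter: convergence against every
linear functional that is bounded for the norm `mrNorm`. -/
def WeakTendstoMR {ι : Type*} (v : ι → MRSpace p j a b) (l : Filter ι)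
    (w : MRSpace p j a b) : Prop :=
  ∀ φ : MRSpace p j a b →ₗ[ℝ] ℝ, (∃ C : ℝ, ∀ u, |φ u| ≤ C * mrNorm p j a b u) →
    Tendsto (fun i => φ (v i)) l (𝓝 (φ w))

end Spaces

end

end MaxReg

namespace MaxReg

/-! The problem `v' + B v = f`, `v(a) = 0` is recast as inverting the bounded operator `evolOp`,
`(u, w) ↦ w + B u`, on `zeroTraceSpace`, the pairs for which `u` is the primitive of `w` from `a`
(`isSolution_iff`). The inverse is required to be causal (`CausalInverse`): data vanishing before
`τ` give a solution vanishing before `τ`. Causality survives small perturbations by a Neumann series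
(`CausalInverse.perturb`), and it allows two coefficient families to be glued at any time
(`CausalInverse.switch`), so no trace space for initial values is needed.

A constant operator with maximal regularity on the half line is causally solvable on `(a, b)`:
solutions are translated and extended by zero, and the bound is the constant of the bounded interval
(`exists_causalInverse_const`). Suppose that near `s` the family `B` differs from such a `C` by at
most `ε‖x‖_D + η‖x‖_X` with `ε K ≤ 1/4`. The `η` term is absorbed on a short interval, since the sup
norm of `j u` is controlled by the `L^p` norm of `u'`. Compactness of `[a, b]` and gluing then give
solvability (`exists_causalInverse_of_local`).

For the limit family, the constant `K` at time `s` is uniform in the parameter. Thus `ε` can be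
fixed first, then a parameter `l` with `A l` uniformly `ε/2`-close to the limit, then the scale of
relative continuity of `A l`; the frozen operator is `A l s`. The uniform constants also give a
uniform lower graph norm bound (`exists_graph_bound`), which passes to limits.

Weak convergence: if `S` solves the limit problem, then `v_l = S (f_l + e_l)`, where the residual
`e_l` is bounded by `‖A_l - A_{l₀}‖_∞ ‖v_l‖` and tends to zero in norm, and the bounded operator `S`
preserves weak convergence. -/

theorem isOpen_timeInterval (a : ℝ) (b : EReal) : IsOpen (timeInterval a b) :=
  (isOpen_lt continuous_const continuous_id).inter
    (isOpen_lt continuous_coe_real_ereal continuous_const)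

theorem measurableSet_timeInterval (a : ℝ) (b : EReal) : MeasurableSet (timeInterval a b) :=
  (isOpen_timeInterval a b).measurableSet

theorem timeInterval_coe (a b : ℝ) : timeInterval a (b : EReal) = Ioo a b := by
  ext t; simp [timeInterval]

theorem timeInterval_top (a : ℝ) : timeInterval a ⊤ = Ioi a := by
  ext t; simp [timeInterval]

theorem Ioc_subset_timeInterval {a T : ℝ} {b : EReal} (hT : T ∈ timeInterval a b) :
    Ioc a T ⊆ timeInterval a b := fun _ ht =>
  ⟨ht.1, lt_of_le_of_lt (EReal.coe_le_coe_iff.2 ht.2) hT.2⟩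

theorem IsTest.exists_Icc {a : ℝ} {b : EReal} {φ : ℝ → ℝ} (hφ : IsTest a b φ)
    (hne : (tsupport φ).Nonempty) :
    ∃ c ∈ timeInterval a b, ∃ d ∈ timeInterval a b, tsupport φ ⊆ Icc c d := by
  have hK : IsCompact (tsupport φ) := hφ.2.1
  refine ⟨sInf (tsupport φ), hφ.2.2 (hK.sInf_mem hne), sSup (tsupport φ),
    hφ.2.2 (hK.sSup_mem hne), fun t ht => ⟨csInf_le hK.bddBelow ht, le_csSup hK.bddAbove ht⟩⟩

theorem IsTest.eq_zero_of_tsupport {φ : ℝ → ℝ} {t : ℝ} (ht : t ∉ tsupport φ) :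
    φ t = 0 ∧ deriv φ t = 0 :=
  ⟨image_eq_zero_of_notMem_tsupport ht,
    image_eq_zero_of_notMem_tsupport fun h => ht (tsupport_deriv_subset h)⟩

/-! ### Weak derivatives: primitives and the du Bois-Reymond lemma -/

section

variable {X : Type*} [NormedAddCommGroup X] [NormedSpace ℝ X]

/-- The weak derivative of a primitive. -/
theorem isWeakDeriv_primitive [CompleteSpace X] {a : ℝ} {b : EReal} {w : ℝ → X}
    (hw : ∀ T ∈ timeInterval a b, IntegrableOn w (Ioc a T)) :
    IsWeakDeriv a b (fun t => ∫ s in a..t, w s) w := by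
  intro φ hφ
  rcases (tsupport φ).eq_empty_or_nonempty with he | hne
  · have h0 : ∀ t, φ t = 0 ∧ deriv φ t = 0 := fun t =>
      IsTest.eq_zero_of_tsupport (by rw [he]; exact notMem_empty t)
    simp [h0]
  obtain ⟨c, hc, T, hT, hsub⟩ := hφ.exists_Icc hne
  have hdc : Continuous (deriv φ) := hφ.1.continuous_deriv (by simp)
  -- Cutting `w` off at `T`, to the right of the support of `φ`, makes it integrable on the line.
  -- Fubini on the triangle `s ≤ t` then leaves `∫_s^∞ φ' = -φ(s)`.
  set w1 : ℝ → X := (Ioc a T).indicator w with hw1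
  have hw1i : Integrable w1 := (integrable_indicator_iff measurableSet_Ioc).2 (hw T hT)
  have hφi : Integrable (deriv φ) := hdc.integrable_of_hasCompactSupport hφ.2.1.deriv
  have hF : Integrable (Function.uncurry fun t s : ℝ =>
      {q : ℝ × ℝ | q.2 ≤ q.1}.indicator (fun q : ℝ × ℝ => deriv φ q.1 • w1 q.2) (t, s))
      (volume.prod volume) :=
    (hφi.smul_prod hw1i).indicator (measurableSet_le measurable_snd measurable_fst)
  have e1 : ∫ t in timeInterval a b, deriv φ t • ∫ s in a..t, w s
      = ∫ t, ∫ s, {q : ℝ × ℝ | q.2 ≤ q.1}.indicator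
        (fun q : ℝ × ℝ => deriv φ q.1 • w1 q.2) (t, s) := by
    rw [setIntegral_eq_integral_of_forall_compl_eq_zero]
    · congr 1; ext t
      by_cases ht : t ∈ tsupport φ
      · have hat : a < t := (hφ.2.2 ht).1
        rw [intervalIntegral.integral_of_le hat.le, ← integral_smul,
          ← integral_indicator measurableSet_Ioc]
        congr 1; ext s
        have hiff : s ∈ Ioc a t ↔ s ≤ t ∧ s ∈ Ioc a T :=
          ⟨fun h => ⟨h.2, h.1, h.2.trans (hsub ht).2⟩, fun h => ⟨h.2.1, h.1⟩⟩
        by_cases h1 : s ≤ t <;> by_cases h2 : s ∈ Ioc a T <;>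
          simp [indicator, hiff, h1, h2, hw1]
      · simp [(IsTest.eq_zero_of_tsupport ht).2, indicator]
    · intro t ht
      rw [(IsTest.eq_zero_of_tsupport fun h => ht (hφ.2.2 h)).2, zero_smul]
  have e2 : ∀ s, ∫ t, {q : ℝ × ℝ | q.2 ≤ q.1}.indicator
      (fun q : ℝ × ℝ => deriv φ q.1 • w1 q.2) (t, s) = -(φ s • w1 s) := by
    intro s
    have : ∀ t, {q : ℝ × ℝ | q.2 ≤ q.1}.indicator
      (fun q : ℝ × ℝ => deriv φ q.1 • w1 q.2) (t, s)
        = (Ici s).indicator (fun t => deriv φ t • w1 s) t := fun t => by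
      simp [indicator]
    simp_rw [this]
    rw [integral_indicator measurableSet_Ici, integral_Ici_eq_integral_Ioi,
      integral_smul_const, hφ.2.1.integral_Ioi_deriv_eq (hφ.1.of_le (by simp)), neg_smul]
  rw [e1, integral_integral_swap hF]
  simp_rw [e2]
  rw [integral_neg, neg_neg, setIntegral_eq_integral_of_forall_compl_eq_zero]
  · congr 1; ext s
    by_cases hs : s ∈ tsupport φ
    · have : s ∈ Ioc a T := ⟨(hφ.2.2 hs).1, (hsub hs).2⟩
      rw [hw1, indicator_of_mem this]
    · rw [(IsTest.eq_zero_of_tsupport hs).1, zero_smul, zero_smul]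
  · intro t ht
    rw [(IsTest.eq_zero_of_tsupport fun h => ht (hφ.2.2 h)).1, zero_smul]

/-- The primitive vanishes to the left of the support trivially and to the right because the mean is
zero, so it is compactly supported in the same interval. -/
theorem IsTest.exists_primitive {a : ℝ} {b : EReal} {ψ : ℝ → ℝ} (hψ : IsTest a b ψ)
    (h0 : ∫ t, ψ t = 0) : ∃ φ, IsTest a b φ ∧ deriv φ = ψ := by
  rcases (tsupport ψ).eq_empty_or_nonempty with he | hne
  · have h0 : ψ = 0 := by
      ext t; exact (IsTest.eq_zero_of_tsupport (by rw [he]; exact notMem_empty t)).1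
    exact ⟨ψ, hψ, by rw [h0]; ext t; simp⟩
  obtain ⟨c, hc, d, hd, hsub⟩ := hψ.exists_Icc hne
  have hz : ∀ t, t ∉ Icc c d → ψ t = 0 := fun t ht =>
    (IsTest.eq_zero_of_tsupport fun h => ht (hsub h)).1
  have hcont : Continuous ψ := hψ.1.continuous
  have hder : ∀ t, HasDerivAt (fun t => ∫ s in c..t, ψ s) (ψ t) t := fun t =>
    intervalIntegral.integral_hasDerivAt_right (hcont.intervalIntegrable _ _)
      hcont.aestronglyMeasurable.stronglyMeasurableAtFilter hcont.continuousAt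
  have hdφ : deriv (fun t => ∫ s in c..t, ψ s) = ψ := funext fun t => (hder t).deriv
  have hz' : ∀ t, t ∉ Icc c d → ∫ s in c..t, ψ s = 0 := by
    intro t ht
    rcases lt_or_ge t c with h | h
    · rw [intervalIntegral.integral_symm, intervalIntegral.integral_zero_ae, neg_zero]
      have : ∀ᵐ x : ℝ, x ≠ c := by simp [ae_iff]
      filter_upwards [this] with x hxc hx
      rw [uIoc_of_le h.le] at hx
      exact hz x fun h' => hxc (le_antisymm hx.2 h'.1)
    · have htd : d < t := by by_contra hcon; exact ht ⟨h, not_lt.1 hcon⟩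
      rw [intervalIntegral.integral_of_le h, ← h0, ← integral_Icc_eq_integral_Ioc]
      refine setIntegral_eq_integral_of_forall_compl_eq_zero fun x hx => hz x fun h' => ?_
      exact hx ⟨h'.1, h'.2.trans htd.le⟩
  have hts : tsupport (fun t => ∫ s in c..t, ψ s) ⊆ Icc c d :=
    closure_minimal (fun t ht => by_contra fun h => ht (hz' t h)) isClosed_Icc
  refine ⟨_, ⟨?_, HasCompactSupport.of_support_subset_isCompact isCompact_Icc
    (subset_tsupport _ |>.trans hts), fun t ht => ?_⟩, hdφ⟩
  · rw [contDiff_infty_iff_deriv, hdφ]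
    exact ⟨fun t => (hder t).differentiableAt, hψ.1⟩
  · exact ⟨hc.1.trans_le (hts ht).1,
      lt_of_le_of_lt (EReal.coe_le_coe_iff.2 (hts ht).2) hd.2⟩

/-- A function with vanishing weak derivative is constant. -/
theorem ae_const_of_weakDeriv_zero [CompleteSpace X] {a : ℝ} {b : EReal} {g : ℝ → X}
    (hg : LocallyIntegrableOn g (timeInterval a b))
    (h : ∀ φ, IsTest a b φ → ∫ t in timeInterval a b, deriv φ t • g t = 0) :
    ∃ k : X, ∀ᵐ t ∂timeMeasure a b, g t = k := by
  rcases (timeInterval a b).eq_empty_or_nonempty with he | ⟨t₀, ht₀⟩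
  · exact ⟨0, by simp [timeMeasure, he]⟩
  have hU := isOpen_timeInterval a b
  obtain ⟨r, hr, hball⟩ := Metric.isOpen_iff.1 hU t₀ ht₀
  -- A test function `θ` of integral one; the constant will be `k = ∫ θ g`.
  let β : ContDiffBump t₀ := ⟨r / 4, r / 2, by linarith, by linarith⟩
  let θ : ℝ → ℝ := β.normed volume
  have hθ : IsTest a b θ := by
    refine ⟨β.contDiff_normed, β.hasCompactSupport_normed, ?_⟩
    rw [β.tsupport_normed_eq]
    refine (Metric.closedBall_subset_ball ?_).trans hball
    change r / 2 < r
    linarith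
  have hθ1 : ∫ t, θ t = 1 := β.integral_normed
  have int_test : ∀ ψ, IsTest a b ψ → Integrable (fun t => ψ t • g t) := by
    intro ψ hψ
    have hK : IsCompact (tsupport ψ) := hψ.2.1
    have h1 : IntegrableOn g (tsupport ψ) := hg.integrableOn_compact_subset hψ.2.2 hK
    have h2 : IntegrableOn (fun t => ψ t • g t) (tsupport ψ) :=
      h1.continuousOn_smul hψ.1.continuous.continuousOn hK
    refine (integrableOn_iff_integrable_of_support_subset fun t ht => ?_).1 h2
    by_contra hcon
    exact ht (by simp [(IsTest.eq_zero_of_tsupport hcon).1])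
  have full : ∀ ψ, IsTest a b ψ →
      ∫ t in timeInterval a b, ψ t • g t = ∫ t, ψ t • g t := by
    intro ψ hψ
    refine setIntegral_eq_integral_of_forall_compl_eq_zero fun t ht => ?_
    rw [(IsTest.eq_zero_of_tsupport fun h => ht (hψ.2.2 h)).1, zero_smul]
  have testint : ∀ ψ, IsTest a b ψ → Integrable ψ := fun ψ hψ =>
    hψ.1.continuous.integrable_of_hasCompactSupport hψ.2.1
  refine ⟨∫ t, θ t • g t, ?_⟩
  set k := ∫ t, θ t • g t
  rw [ae_restrict_iff' hU.measurableSet]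
  have key := hU.ae_eq_zero_of_integral_contDiff_smul_eq_zero
    (f := fun t => g t - k) (μ := volume) (hg.sub (locallyIntegrableOn_const k)) ?_
  · filter_upwards [key] with t ht htU using sub_eq_zero.1 (ht htU)
  intro ψ h1 h2 h3
  have hψ : IsTest a b ψ := ⟨h1, h2, h3⟩
  set m := ∫ t, ψ t
  -- `ψ - m θ` has mean zero, hence is the derivative of a test function, and testing `g` against it
  -- gives `∫ ψ g = m k`.
  have hζ : IsTest a b (fun t => ψ t - m * θ t) := by
    refine ⟨h1.sub (contDiff_const.mul hθ.1), h2.sub hθ.2.1.mul_left, ?_⟩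
    refine closure_minimal (fun t ht => ?_)
      ((isClosed_tsupport ψ).union (isClosed_tsupport θ)) |>.trans (union_subset h3 hθ.2.2)
    by_contra hcon
    rw [mem_union, not_or] at hcon
    exact ht (by simp [(IsTest.eq_zero_of_tsupport hcon.1).1,
      (IsTest.eq_zero_of_tsupport hcon.2).1])
  obtain ⟨φ, hφ, hdφ⟩ := hζ.exists_primitive (by
    rw [integral_sub (testint ψ hψ) ((testint θ hθ).const_mul m), integral_const_mul, hθ1,
      mul_one, sub_self])
  have h5 := h φ hφ
  rw [hdφ, full _ hζ] at h5
  simp_rw [sub_smul, mul_smul] at h5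
  have h6 := integral_sub (int_test ψ hψ) ((int_test θ hθ).smul m)
  simp only [Pi.smul_apply] at h6
  rw [h6, integral_smul] at h5
  simp_rw [smul_sub]
  rw [integral_sub (int_test ψ hψ) ((testint ψ hψ).smul_const k), integral_smul_const]
  exact h5

end

/-! ### Elements with zero initial value as primitives -/

section Spaces

variable {X D : Type*} [NormedAddCommGroup X] [NormedSpace ℝ X]
  [NormedAddCommGroup D] [NormedSpace ℝ D]
  {p : ℝ≥0∞} [Fact (1 ≤ p)] {j : D →L[ℝ] X} {a : ℝ} {b : EReal}

theorem integrableOn_Ioc_of_lp {E : Type*} [NormedAddCommGroup E]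
    (w : Lp E p (timeMeasure a b)) {T : ℝ}
    (hT : T ∈ timeInterval a b) : IntegrableOn w (Ioc a T) := by
  have h := Lp.memLp w
  generalize (w : ℝ → E) = g at h ⊢
  exact (h.mono_measure (Measure.restrict_mono (Ioc_subset_timeInterval hT) le_rfl)).integrable
    Fact.out

theorem continuousOn_primitive_timeInterval {w : ℝ → X}
    (hw : ∀ T ∈ timeInterval a b, IntegrableOn w (Ioc a T)) :
    ContinuousOn (fun t => ∫ s in a..t, w s) (timeInterval a b) := by
  intro t ht
  obtain ⟨T, hT⟩ : ∃ T ∈ timeInterval a b, t < T := by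
    obtain ⟨r, hr, hball⟩ := Metric.isOpen_iff.1 (isOpen_timeInterval a b) t ht
    exact ⟨t + r / 2, hball (by simp [abs_of_pos hr]; linarith), by linarith⟩
  have haT : a < T := hT.1.1
  have h1 : ContinuousOn (fun t => ∫ s in a..t, w s) (uIcc a T) :=
    intervalIntegral.continuousOn_primitive_interval (by
      rw [uIcc_of_le haT.le, integrableOn_Icc_iff_integrableOn_Ioc]; exact hw T hT.1)
  rw [uIcc_of_le haT.le] at h1
  exact (h1.continuousAt (Icc_mem_nhds ht.1 hT.2)).continuousWithinAt

theorem tendsto_primitive_left (hab : (timeInterval a b).Nonempty) {w : ℝ → X}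
    (hw : ∀ T ∈ timeInterval a b, IntegrableOn w (Ioc a T)) :
    Tendsto (fun t => ∫ s in a..t, w s) (𝓝[timeInterval a b] a) (𝓝 0) := by
  obtain ⟨T, hT⟩ := hab
  have haT : a < T := hT.1
  have h1 : ContinuousOn (fun t => ∫ s in a..t, w s) (uIcc a T) :=
    intervalIntegral.continuousOn_primitive_interval (by
      rw [uIcc_of_le haT.le, integrableOn_Icc_iff_integrableOn_Ioc]; exact hw T hT)
  rw [uIcc_of_le haT.le] at h1
  have h2 := (h1 a ⟨le_rfl, haT.le⟩).tendsto
  simp only [intervalIntegral.integral_same] at h2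
  refine h2.mono_left ?_
  refine nhdsWithin_le_iff.2 ?_
  refine mem_nhdsWithin.2 ⟨Iio T, isOpen_Iio, haT, fun t ht => ⟨ht.2.1.le, ht.1.le⟩⟩

/-- An element of the maximal regularity space that vanishes at the left end point is the primitive
of its weak derivative. -/
theorem ae_eq_primitive_of_zeroAtLeft [CompleteSpace X]
    (v : MRSpace p j a b) (hv : ZeroAtLeft p j a b v) :
    ∀ᵐ t ∂timeMeasure a b, j (v.1.1 t) = ∫ s in a..t, v.1.2 s := by
  have hp : 1 ≤ p := Fact.out
  rcases (timeInterval a b).eq_empty_or_nonempty with he | hne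
  · simp [timeMeasure, he]
  have hw : ∀ T ∈ timeInterval a b, IntegrableOn v.1.2 (Ioc a T) := fun T hT =>
    integrableOn_Ioc_of_lp _ hT
  have hcontW := continuousOn_primitive_timeInterval hw
  have hju : MemLp (fun t => j (v.1.1 t)) p (timeMeasure a b) := j.comp_memLp' (Lp.memLp v.1.1)
  have hlocu : LocallyIntegrableOn (fun t => j (v.1.1 t)) (timeInterval a b) :=
    locallyIntegrableOn_of_locallyIntegrable_restrict (hju.locallyIntegrable hp)
  have hlocW : LocallyIntegrableOn (fun t => ∫ s in a..t, v.1.2 s) (timeInterval a b) :=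
    hcontW.locallyIntegrableOn (measurableSet_timeInterval a b)
  obtain ⟨k, hk⟩ := ae_const_of_weakDeriv_zero (hlocu.sub hlocW) (by
    intro φ hφ
    have hK : IsCompact (tsupport φ) := hφ.2.1
    have hd : Continuous (deriv φ) := hφ.1.continuous_deriv (by simp)
    have i0 : ∀ g : ℝ → X, LocallyIntegrableOn g (timeInterval a b) →
        IntegrableOn (fun t => deriv φ t • g t) (timeInterval a b) := by
      intro g hg
      have h2 : IntegrableOn (fun t => deriv φ t • g t) (tsupport φ) :=
        (hg.integrableOn_compact_subset hφ.2.2 hK).continuousOn_smul hd.continuousOn hK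
      refine Integrable.integrableOn
        ((integrableOn_iff_integrable_of_support_subset fun t ht => ?_).1 h2)
      by_contra hcon
      exact ht (by simp [(IsTest.eq_zero_of_tsupport hcon).2])
    have h1 : -∫ t in timeInterval a b, deriv φ t • j (v.1.1 t)
      = ∫ t in timeInterval a b, φ t • v.1.2 t := v.2 φ hφ
    have h2 := isWeakDeriv_primitive hw φ hφ
    simp only [Pi.sub_apply, smul_sub]
    rw [integral_sub (i0 _ hlocu) (i0 _ hlocW), sub_eq_zero]
    exact neg_injective (h1.trans h2.symm))
  obtain ⟨c, hc, hcu, hc0⟩ := hv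
  -- The continuous representative minus the primitive equals `k` everywhere on the open interval,
  -- and both terms tend to zero at `a`.
  have hk0 : k = 0 := by
    have hacl : a ∈ closure (timeInterval a b) := by
      obtain ⟨T, hT⟩ := hne
      have hm : a ∈ closure (Ioc a T) := by
        rw [closure_Ioc hT.1.ne]; exact ⟨le_rfl, hT.1.le⟩
      exact closure_mono (Ioc_subset_timeInterval hT) hm
    have hall : ∀ t ∈ timeInterval a b, c t - ∫ s in a..t, v.1.2 s = k := by
      have := Measure.eqOn_open_of_ae_eq (μ := volume) (U := timeInterval a b)
        (f := fun t => c t - ∫ s in a..t, v.1.2 s) (g := fun _ => k) ?_ (isOpen_timeInterval a b)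
        ((hc.mono subset_closure).sub hcontW) continuousOn_const
      · exact fun t ht => this ht
      · filter_upwards [hk, hcu] with t h1 h2
        rw [h2]; exact h1
    have h1 : Tendsto (fun t => c t - ∫ s in a..t, v.1.2 s) (𝓝[timeInterval a b] a)
        (𝓝 (0 - 0)) := by
      refine Tendsto.sub ?_ (tendsto_primitive_left hne hw)
      rw [← hc0]
      exact (hc a hacl).tendsto.mono_left (nhdsWithin_mono _ subset_closure)
    have h2 : Tendsto (fun t => c t - ∫ s in a..t, v.1.2 s) (𝓝[timeInterval a b] a) (𝓝 k) :=
      tendsto_const_nhds.congr' (by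
        filter_upwards [self_mem_nhdsWithin] with t ht using (hall t ht).symm)
    have : (𝓝[timeInterval a b] a).NeBot := mem_closure_iff_nhdsWithin_neBot.1 hacl
    simpa using tendsto_nhds_unique h2 h1
  filter_upwards [hk] with t ht
  rw [hk0] at ht
  exact sub_eq_zero.1 ht

theorem integrableOn_lp {E : Type*} [NormedAddCommGroup E] {b : ℝ}
    (w : Lp E p (timeMeasure a b)) :
    IntegrableOn w (Ioo a b) := by
  have h := Lp.memLp w
  generalize (w : ℝ → E) = g at h ⊢
  rw [timeMeasure, timeInterval_coe] at h
  exact h.integrable Fact.out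

/-- Conversely, a primitive of an `L^p` function lies in the maximal regularity space as soon as it
is an `L^p` function with values in `D`, and it vanishes at the left end point. -/
theorem exists_mrSpace_of_primitive [CompleteSpace X] {b : ℝ} (hab : a < b)
    (z : Lp D p (timeMeasure a b) × Lp X p (timeMeasure a b))
    (hz : ∀ᵐ t ∂timeMeasure a b, j (z.1 t) = ∫ s in a..t, z.2 s) :
    ∃ h : z ∈ MRSpace p j a b, ZeroAtLeft p j a b ⟨z, h⟩ := by
  have hmem : z ∈ MRSpace p j a b := by
    intro φ hφ
    rw [← isWeakDeriv_primitive (fun T hT => integrableOn_Ioc_of_lp z.2 hT) φ hφ]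
    congr 1
    refine integral_congr_ae ?_
    filter_upwards [hz] with t ht
    rw [ht]
  refine ⟨hmem, fun t => ∫ s in a..t, z.2 s, ?_, ?_, by simp⟩
  · rw [timeInterval_coe, closure_Ioo hab.ne, ← uIcc_of_le hab.le]
    refine intervalIntegral.continuousOn_primitive_interval ?_
    rw [uIcc_of_le hab.le, integrableOn_Icc_iff_integrableOn_Ioo]
    exact integrableOn_lp z.2
  · filter_upwards [hz] with t ht using ht.symm

end Spaces

/-! ### Functions vanishing before a given time -/

section VanishBefore

variable {E : Type*} [NormedAddCommGroup E] {μ : Measure ℝ} {p : ℝ≥0∞}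

/-- `f` vanishes almost everywhere before time `τ`. -/
def VanishBefore (τ : ℝ) (f : Lp E p μ) : Prop := ∀ᵐ t ∂μ, t < τ → f t = 0

theorem VanishBefore.add {τ : ℝ} {f g : Lp E p μ} (hf : VanishBefore τ f)
    (hg : VanishBefore τ g) : VanishBefore τ (f + g) := by
  filter_upwards [hf, hg, Lp.coeFn_add f g] with t h1 h2 h3 ht
  rw [h3, Pi.add_apply, h1 ht, h2 ht, add_zero]

theorem VanishBefore.sub {τ : ℝ} {f g : Lp E p μ} (hf : VanishBefore τ f)
    (hg : VanishBefore τ g) : VanishBefore τ (f - g) := by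
  filter_upwards [hf, hg, Lp.coeFn_sub f g] with t h1 h2 h3 ht
  rw [h3, Pi.sub_apply, h1 ht, h2 ht, sub_zero]

end VanishBefore

/-! ### Multiplication by bounded operator families -/

section Multiplication

variable {E F : Type*} [NormedAddCommGroup E] [NormedSpace ℝ E]
  [NormedAddCommGroup F] [NormedSpace ℝ F] {μ : Measure ℝ} {p : ℝ≥0∞}

/-- An essentially bounded family of operators, strongly measurable in the strong operator
topology. -/
structure AEBddOp (μ : Measure ℝ) (B : ℝ → E →L[ℝ] F) : Prop where
  meas : ∀ x, AEStronglyMeasurable (fun t => B t x) μ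
  bdd : ∃ L : ℝ, ∀ᵐ t ∂μ, ‖B t‖ ≤ L

theorem AEBddOp.const (C : E →L[ℝ] F) : AEBddOp μ (fun _ => C) :=
  ⟨fun _ => aestronglyMeasurable_const, ‖C‖, Eventually.of_forall fun _ => le_rfl⟩

theorem AEBddOp.ite {B C : ℝ → E →L[ℝ] F} (hB : AEBddOp μ B) (hC : AEBddOp μ C) {s : Set ℝ}
    [DecidablePred (· ∈ s)] (hs : MeasurableSet s) :
    AEBddOp μ (fun t => if t ∈ s then B t else C t) := by
  refine ⟨fun x => ?_, ?_⟩
  · have : (fun t => (if t ∈ s then B t else C t) x)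
        = s.piecewise (fun t => B t x) (fun t => C t x) := by
      ext t; by_cases h : t ∈ s <;> simp [h]
    rw [this]
    exact (hB.meas x).restrict.piecewise hs (hC.meas x).restrict
  · obtain ⟨L, hL⟩ := hB.bdd
    obtain ⟨L', hL'⟩ := hC.bdd
    refine ⟨max L L', ?_⟩
    filter_upwards [hL, hL'] with t h1 h2
    split_ifs
    · exact h1.trans (le_max_left _ _)
    · exact h2.trans (le_max_right _ _)

/-- On a simple function the result is a finite sum of indicators times `B t y`; the general case is
a pointwise limit, each `B t` being continuous. -/
theorem AEBddOp.aestronglyMeasurable {B : ℝ → E →L[ℝ] F} (hB : AEBddOp μ B) {u : ℝ → E}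
    (hu : AEStronglyMeasurable u μ) : AEStronglyMeasurable (fun t => B t (u t)) μ := by
  have hs : ∀ s : SimpleFunc ℝ E, AEStronglyMeasurable (fun t => B t (s t)) μ := by
    intro s
    have : (fun t => B t (s t))
        = fun t => ∑ y ∈ s.range, (s ⁻¹' {y}).indicator (fun t => B t y) t := by
      ext t
      rw [Finset.sum_eq_single (s t)]
      · simp
      · intro y _ hy
        exact indicator_of_notMem (fun h => hy h.symm) _
      · intro h; exact absurd (s.mem_range_self t) h
    rw [this]
    exact Finset.aestronglyMeasurable_fun_sum _ fun y _ =>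
      (hB.meas y).indicator (s.measurableSet_fiber y)
  have h1 : AEStronglyMeasurable (fun t => B t (hu.mk u t)) μ :=
    aestronglyMeasurable_of_tendsto_ae atTop
      (fun n => hs (hu.stronglyMeasurable_mk.approx n))
      (Eventually.of_forall fun t => ((B t).continuous.tendsto _).comp
        (hu.stronglyMeasurable_mk.tendsto_approx t))
  refine h1.congr ?_
  filter_upwards [hu.ae_eq_mk] with t ht
  rw [ht]

theorem AEBddOp.memLp {B : ℝ → E →L[ℝ] F} (hB : AEBddOp μ B) {u : ℝ → E} (hu : MemLp u p μ) :
    MemLp (fun t => B t (u t)) p μ := by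
  obtain ⟨L, hL⟩ := hB.bdd
  refine hu.of_le_mul (c := L) (hB.aestronglyMeasurable hu.1) ?_
  filter_upwards [hL] with t ht
  exact (B t).le_of_opNorm_le ht _

variable [Fact (1 ≤ p)]

/-- Pointwise application of an essentially bounded family of operators. -/
noncomputable def mulLp (p : ℝ≥0∞) [Fact (1 ≤ p)] {B : ℝ → E →L[ℝ] F} (hB : AEBddOp μ B) :
    Lp E p μ →L[ℝ] Lp F p μ :=
  LinearMap.mkContinuousOfExistsBound
    { toFun := fun u => (hB.memLp (Lp.memLp u)).toLp
      map_add' := fun u v => by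
        rw [← MemLp.toLp_add, MemLp.toLp_eq_toLp_iff]
        filter_upwards [Lp.coeFn_add u v] with t ht
        change B t ((u + v : Lp E p μ) t) = B t (u t) + B t (v t)
        rw [ht, Pi.add_apply, map_add]
      map_smul' := fun c u => by
        rw [RingHom.id_apply, ← MemLp.toLp_const_smul, MemLp.toLp_eq_toLp_iff]
        filter_upwards [Lp.coeFn_smul c u] with t ht
        change B t ((c • u : Lp E p μ) t) = c • B t (u t)
        rw [ht, Pi.smul_apply, map_smul] }
    (by
      obtain ⟨L, hL⟩ := hB.bdd
      refine ⟨L, fun u => Lp.norm_le_mul_norm_of_ae_le_mul ?_⟩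
      filter_upwards [hL, (hB.memLp (Lp.memLp u)).coeFn_toLp] with t ht h2
      simp only [LinearMap.coe_mk, AddHom.coe_mk]
      rw [h2]
      exact (B t).le_of_opNorm_le ht _)

theorem coeFn_mulLp {B : ℝ → E →L[ℝ] F} (hB : AEBddOp μ B) (u : Lp E p μ) :
    ∀ᵐ t ∂μ, mulLp p hB u t = B t (u t) :=
  (hB.memLp (Lp.memLp u)).coeFn_toLp

theorem VanishBefore.mulLp {τ : ℝ} {f : Lp E p μ} (hf : VanishBefore τ f)
    {B : ℝ → E →L[ℝ] F} (hB : AEBddOp μ B) : VanishBefore τ (mulLp p hB f) := by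
  filter_upwards [hf, coeFn_mulLp hB f] with t h1 h2 ht
  rw [h2, h1 ht, map_zero]

/-- Truncation to the times before `τ`. -/
theorem exists_truncation (μ : Measure ℝ) (p : ℝ≥0∞) [Fact (1 ≤ p)] (E : Type*)
    [NormedAddCommGroup E] [NormedSpace ℝ E] (τ : ℝ) :
    ∃ χ : Lp E p μ →L[ℝ] Lp E p μ, (∀ f, ‖χ f‖ ≤ ‖f‖) ∧ (∀ f, VanishBefore τ (f - χ f)) ∧
      ∀ f, VanishBefore τ f ↔ χ f = 0 := by
  classical
  have hB : AEBddOp μ (fun t => if t ∈ Iio τ then ContinuousLinearMap.id ℝ E else 0) :=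
    (AEBddOp.const _).ite (AEBddOp.const _) measurableSet_Iio
  refine ⟨MaxReg.mulLp p hB, fun f => Lp.norm_le_norm_of_ae_le ?_, fun f => ?_, fun f => ?_⟩
  · filter_upwards [coeFn_mulLp hB f] with t ht
    rw [ht]
    split_ifs <;> simp
  · filter_upwards [coeFn_mulLp hB f, Lp.coeFn_sub f (MaxReg.mulLp p hB f)] with t h1 h2 ht
    rw [h2, Pi.sub_apply, h1, if_pos (mem_Iio.2 ht)]; simp
  · rw [Lp.eq_zero_iff_ae_eq_zero]
    refine eventually_congr ?_
    filter_upwards [coeFn_mulLp hB f] with t ht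
    rw [ht, Pi.zero_apply]
    by_cases h : t < τ <;> simp [h]

end Multiplication

/-! ### Causal solution operators: perturbation and gluing -/

section Causal

variable {X D : Type*} [NormedAddCommGroup X] [NormedSpace ℝ X]
  [NormedAddCommGroup D] [NormedSpace ℝ D]

theorem primitive_congr_ae {a : ℝ} {b : EReal} {f g : ℝ → X} (h : f =ᵐ[timeMeasure a b] g)
    {t : ℝ} (ht : t ∈ timeInterval a b) : ∫ s in a..t, f s = ∫ s in a..t, g s := by
  rw [intervalIntegral.integral_of_le ht.1.le, intervalIntegral.integral_of_le ht.1.le]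
  exact integral_congr_ae
    (ae_mono (Measure.restrict_mono (Ioc_subset_timeInterval ht) le_rfl) h)

theorem ae_mem_timeInterval (a : ℝ) (b : EReal) :
    ∀ᵐ t ∂timeMeasure a b, t ∈ timeInterval a b :=
  ae_restrict_mem (measurableSet_timeInterval a b)

/-- The pairs `(u, u')` such that `u` is the primitive of `u'` vanishing at the left end point. -/
def zeroTraceSpace (p : ℝ≥0∞) [Fact (1 ≤ p)] (j : D →L[ℝ] X) (a : ℝ) (b : EReal) :
    Submodule ℝ (Lp D p (timeMeasure a b) × Lp X p (timeMeasure a b)) where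
  carrier := {z | ∀ᵐ t ∂timeMeasure a b, j (z.1 t) = ∫ s in a..t, z.2 s}
  zero_mem' := by
    filter_upwards [Lp.coeFn_zero D p (timeMeasure a b), ae_mem_timeInterval a b] with t h1 h2
    change j ((0 : Lp D p (timeMeasure a b)) t)
      = ∫ s in a..t, (0 : Lp X p (timeMeasure a b)) s
    rw [primitive_congr_ae (Lp.coeFn_zero X p (timeMeasure a b)) h2, h1]
    simp
  add_mem' := by
    intro z w hz hw
    filter_upwards [hz, hw, Lp.coeFn_add z.1 w.1, ae_mem_timeInterval a b] with t h1 h2 h3 ht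
    have i1 := (intervalIntegrable_iff_integrableOn_Ioc_of_le ht.1.le).2
      (integrableOn_Ioc_of_lp z.2 ht)
    have i2 := (intervalIntegrable_iff_integrableOn_Ioc_of_le ht.1.le).2
      (integrableOn_Ioc_of_lp w.2 ht)
    rw [Prod.fst_add, Prod.snd_add, primitive_congr_ae (Lp.coeFn_add z.2 w.2) ht, h3]
    simp only [Pi.add_apply, map_add]
    rw [intervalIntegral.integral_add i1 i2, h1, h2]
  smul_mem' := by
    intro c z hz
    filter_upwards [hz, Lp.coeFn_smul c z.1, ae_mem_timeInterval a b] with t h1 h3 ht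
    rw [Prod.smul_fst, Prod.smul_snd, primitive_congr_ae (Lp.coeFn_smul c z.2) ht, h3]
    simp only [Pi.smul_apply, map_smul]
    rw [intervalIntegral.integral_smul, h1]

variable {p : ℝ≥0∞} [Fact (1 ≤ p)] {j : D →L[ℝ] X} {a b : ℝ}

/-- The operator `u ↦ u' + B u`. -/
noncomputable def evolOp (p : ℝ≥0∞) [Fact (1 ≤ p)] {μ : Measure ℝ} {B : ℝ → D →L[ℝ] X}
    (hB : AEBddOp μ B) : (Lp D p μ × Lp X p μ) →L[ℝ] Lp X p μ :=
  ContinuousLinearMap.snd ℝ _ _ + (mulLp p hB).comp (ContinuousLinearMap.fst ℝ _ _)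

theorem evolOp_apply {μ : Measure ℝ} {B : ℝ → D →L[ℝ] X} (hB : AEBddOp μ B)
    (z : Lp D p μ × Lp X p μ) : evolOp p hB z = z.2 + mulLp p hB z.1 := rfl

theorem coeFn_evolOp {μ : Measure ℝ} {B : ℝ → D →L[ℝ] X} (hB : AEBddOp μ B)
    (z : Lp D p μ × Lp X p μ) : ∀ᵐ t ∂μ, evolOp p hB z t = z.2 t + B t (z.1 t) := by
  rw [evolOp_apply]
  filter_upwards [Lp.coeFn_add z.2 (mulLp p hB z.1), coeFn_mulLp hB z.1] with t h1 h2
  rw [h1, Pi.add_apply, h2]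

/-- `S` is the solution operator of the problem `u' + B u = f`, `u(a) = 0`, and it is causal. -/
structure CausalInverse (j : D →L[ℝ] X) {B : ℝ → D →L[ℝ] X} (hB : AEBddOp (timeMeasure a b) B)
    (S : Lp X p (timeMeasure a b) →L[ℝ] Lp D p (timeMeasure a b) × Lp X p (timeMeasure a b)) :
    Prop where
  mem : ∀ f, S f ∈ zeroTraceSpace p j a b
  right_inv : ∀ f, evolOp p hB (S f) = f
  inj : ∀ z ∈ zeroTraceSpace p j a b, evolOp p hB z = 0 → z = 0
  causal : ∀ τ f, VanishBefore τ f → VanishBefore τ (S f).1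

theorem CausalInverse.left_inv {B : ℝ → D →L[ℝ] X} {hB : AEBddOp (timeMeasure a b) B}
    {S : Lp X p (timeMeasure a b) →L[ℝ] Lp D p (timeMeasure a b) × Lp X p (timeMeasure a b)}
    (h : CausalInverse j hB S) {z : Lp D p (timeMeasure a b) × Lp X p (timeMeasure a b)}
    (hz : z ∈ zeroTraceSpace p j a b) : S (evolOp p hB z) = z := by
  refine sub_eq_zero.1 (h.inj _ (sub_mem (h.mem _) hz) ?_)
  rw [map_sub, h.right_inv, sub_self]

/-- Stability of causal solvability under small perturbations. -/
theorem CausalInverse.perturb [CompleteSpace X]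
    {B C : ℝ → D →L[ℝ] X} {hB : AEBddOp (timeMeasure a b) B}
    {hC : AEBddOp (timeMeasure a b) C}
    {S : Lp X p (timeMeasure a b) →L[ℝ] Lp D p (timeMeasure a b) × Lp X p (timeMeasure a b)}
    (h : CausalInverse j hC S) {c : ℝ} (hc0 : 0 ≤ c) (hc : c < 1)
    (hsmall : ∀ f, ‖mulLp p hB (S f).1 - mulLp p hC (S f).1‖ ≤ c * ‖f‖) :
    ∃ T, CausalInverse (p := p) j hB T := by
  -- With `Q = (B - C) S` one has `evolOp p hB ∘ S = 1 + Q`, so the new solution operator is `S (1 +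
  -- Q)⁻¹`.
  let Q : Lp X p (timeMeasure a b) →L[ℝ] Lp X p (timeMeasure a b) :=
    (mulLp p hB - mulLp p hC).comp ((ContinuousLinearMap.fst ℝ _ _).comp S)
  have hQ : ∀ f, Q f = mulLp p hB (S f).1 - mulLp p hC (S f).1 := fun _ => rfl
  have hQn : ‖-Q‖ < 1 := by
    rw [norm_neg]
    exact (Q.opNorm_le_bound hc0 hsmall).trans_lt hc
  let U := Units.oneSub (-Q) hQn
  have hev : ∀ z, evolOp p hB z = evolOp p hC z + (mulLp p hB z.1 - mulLp p hC z.1) := by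
    intro z; rw [evolOp_apply, evolOp_apply]; abel
  have hR : ∀ f, U.inv f + Q (U.inv f) = f := by
    intro f
    have h1 : (U.val * U.inv) f = f := by rw [U.val_inv]; rfl
    have h2 : U.val = 1 - -Q := rfl
    rw [h2, sub_neg_eq_add] at h1
    exact h1
  refine ⟨S.comp U.inv, fun f => h.mem _, fun f => ?_, fun z hz h0 => ?_, fun τ f hf => ?_⟩
  · rw [ContinuousLinearMap.comp_apply, hev, h.right_inv, ← hQ, hR]
  -- If `z` is in the kernel for `B`, then `g = -Q g`, and the contraction forces `g = 0`.
  · set g := evolOp p hC z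
    have hz' : S g = z := h.left_inv hz
    rw [hev, ← hz', ← hQ, hz', add_comm] at h0
    have h1 : ‖g‖ ≤ c * ‖g‖ := by
      have := hsmall g
      rwa [← hQ, eq_neg_of_add_eq_zero_left h0, norm_neg] at this
    have h2 : g = 0 := by
      rw [← norm_eq_zero]; nlinarith [norm_nonneg g]
    rw [← hz', h2, map_zero]
  -- Causality of `(1 + Q)⁻¹`: as `Q` is causal, the part of `Q g` before `τ` depends only on `χ g`,
  -- so `χ g = -χ Q χ g`, and the contraction gives `χ g = 0`.
  · have hQc : ∀ g, VanishBefore τ g → VanishBefore τ (Q g) := fun g hg =>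
      ((h.causal τ g hg).mulLp hB).sub ((h.causal τ g hg).mulLp hC)
    obtain ⟨χ, h1, h2, h3⟩ := exists_truncation (timeMeasure a b) p X τ
    refine h.causal τ _ ((h3 _).2 ?_)
    set g := U.inv f
    have e1 : χ g + χ (Q g) = 0 := by rw [← map_add, hR, (h3 f).1 hf]
    have e2 : χ (Q g) = χ (Q (χ g)) := by
      rw [← sub_eq_zero, ← map_sub, ← map_sub]
      exact (h3 _).1 (hQc _ (h2 g))
    have e3 : ‖χ g‖ ≤ c * ‖χ g‖ := by
      rw [e2] at e1
      calc ‖χ g‖ = ‖χ (Q (χ g))‖ := 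
            (congrArg norm (eq_neg_of_add_eq_zero_left e1)).trans (norm_neg _)
        _ ≤ ‖Q (χ g)‖ := h1 _
        _ ≤ c * ‖χ g‖ := hsmall _
    have e4 : ‖χ g‖ = 0 := by nlinarith [norm_nonneg (χ g)]
    exact norm_eq_zero.1 e4

open Classical in
/-- Two causally solvable operators may be switched at any time. -/
theorem CausalInverse.switch {B₁ B₂ : ℝ → D →L[ℝ] X} {hB₁ : AEBddOp (timeMeasure a b) B₁}
    {hB₂ : AEBddOp (timeMeasure a b) B₂}
    {S₁ S₂ : Lp X p (timeMeasure a b) →L[ℝ] Lp D p (timeMeasure a b) × Lp X p (timeMeasure a b)}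
    (h₁ : CausalInverse j hB₁ S₁) (h₂ : CausalInverse j hB₂ S₂) (σ : ℝ) :
    ∃ T, CausalInverse (p := p) j (hB₁.ite hB₂ (measurableSet_Iio (a := σ))) T := by
  set hB := hB₁.ite hB₂ (measurableSet_Iio (a := σ))
  set L := evolOp p hB
  have before : ∀ z, VanishBefore σ (L z - evolOp p hB₁ z) := by
    intro z
    filter_upwards [coeFn_evolOp hB z, coeFn_evolOp hB₁ z,
      Lp.coeFn_sub (L z) (evolOp p hB₁ z)] with t h1 h2 h3 ht
    rw [h3, Pi.sub_apply, h1, h2, if_pos (mem_Iio.2 ht), sub_self]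
  have after : ∀ z, VanishBefore σ z.1 → L z = evolOp p hB₂ z := by
    intro z hz
    refine Lp.ext ?_
    filter_upwards [coeFn_evolOp hB z, coeFn_evolOp hB₂ z, hz] with t h1 h2 h3
    rw [h1, h2]
    by_cases ht : t < σ
    · rw [h3 ht, map_zero, map_zero]
    · rw [if_neg (by simpa using ht)]
  have causL : ∀ τ f, VanishBefore τ f → VanishBefore τ (L (S₁ f)) := by
    intro τ f hf
    have hu := h₁.causal τ f hf
    have hw : VanishBefore τ (S₁ f).2 := by
      have : (S₁ f).2 = f - mulLp p hB₁ (S₁ f).1 := by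
        rw [eq_sub_iff_add_eq, ← evolOp_apply, h₁.right_inv]
      rw [this]
      exact hf.sub (hu.mulLp hB₁)
    exact hw.add (hu.mulLp hB)
  have vz : ∀ f, VanishBefore σ (f - L (S₁ f)) := by
    intro f
    have h1 := before (S₁ f)
    rw [h₁.right_inv] at h1
    have h0 : VanishBefore σ (0 : Lp X p (timeMeasure a b)) := by
      filter_upwards [Lp.coeFn_zero X p (timeMeasure a b)] with t ht _
      simpa using ht
    have := h0.sub h1
    rwa [zero_sub, neg_sub] at this
  -- `S₁ f` solves the switched problem before `σ`. Its residual `f - L (S₁ f)` vanishes before `σ`,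
  -- hence so does the correction by `S₂`, on which `L` acts as the operator of `B₂`.
  refine ⟨S₁ + S₂.comp (ContinuousLinearMap.id ℝ _ - L.comp S₁), fun f => ?_, fun f => ?_,
    fun z hz h0 => ?_, fun τ f hf => ?_⟩
  · exact add_mem (h₁.mem _) (h₂.mem _)
  · change L (S₁ f + S₂ (f - L (S₁ f))) = f
    rw [map_add, after _ (h₂.causal _ _ (vz f)), h₂.right_inv]
    abel
  -- A kernel element vanishes before `σ` by causality of `S₁`, so it lies in the kernel for `B₂`.
  · have h1 := before z
    have h2 : VanishBefore σ (evolOp p hB₁ z) := by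
      have h3 : L z = 0 := h0
      rw [h3, zero_sub] at h1
      filter_upwards [h1, Lp.coeFn_neg (evolOp p hB₁ z)] with t e1 e2 ht
      have := e1 ht
      rwa [e2, Pi.neg_apply, neg_eq_zero] at this
    have h3 := h₁.causal _ _ h2
    rw [h₁.left_inv hz] at h3
    exact h₂.inj z hz ((after z h3).symm.trans h0)
  · exact (h₁.causal τ f hf).add (h₂.causal τ _ (hf.sub (causL τ f hf)))

end Causal

/-! ### Constant operators: from the half line to a bounded interval -/

section Autonomous

variable {X D : Type*} [NormedAddCommGroup X] [NormedSpace ℝ X]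
  [NormedAddCommGroup D] [NormedSpace ℝ D]
  {p : ℝ≥0∞} [Fact (1 ≤ p)] {j : D →L[ℝ] X} {a b : ℝ}

theorem derivWeight_coe (a b : ℝ) : derivWeight a (b : EReal) = b - a := by
  simp [derivWeight]

theorem one_le_toReal (hp : p ≠ ⊤) : 1 ≤ p.toReal := by
  have := ENNReal.toReal_mono hp (Fact.out : 1 ≤ p)
  simpa using this

theorem le_rpow_sum {x y z q : ℝ} (hq : 1 ≤ q) (hx : 0 ≤ x) (hy : 0 ≤ y) (hz : 0 ≤ z) :
    y ≤ (x ^ q + y ^ q + z ^ q) ^ (1 / q) := by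
  have h0 : 0 < q := by linarith
  calc y = (y ^ q) ^ (1 / q) := by
        rw [← Real.rpow_mul hy, mul_one_div_cancel h0.ne', Real.rpow_one]
    _ ≤ _ := by
        refine Real.rpow_le_rpow (by positivity) ?_ (by positivity)
        have := Real.rpow_nonneg hx q
        have := Real.rpow_nonneg hz q
        linarith

theorem rpow_sum_le {x y z q : ℝ} (hq : 1 ≤ q) (hx : 0 ≤ x) (hy : 0 ≤ y) (hz : 0 ≤ z) :
    (x ^ q + y ^ q + z ^ q) ^ (1 / q) ≤ x + y + z := by
  have h0 : 0 < q := by linarith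
  have h1 := Real.add_rpow_le_rpow_add hx hy hq
  have h2 := Real.add_rpow_le_rpow_add (add_nonneg hx hy) hz hq
  calc _ ≤ ((x + y + z) ^ q) ^ (1 / q) :=
        Real.rpow_le_rpow (by positivity) (by linarith) (by positivity)
    _ = x + y + z := by
        rw [← Real.rpow_mul (by positivity), mul_one_div_cancel h0.ne', Real.rpow_one]

theorem norm_le_mrNorm (hp : p ≠ ⊤) (hab : a ≤ b) (v : MRSpace p j a b) :
    ‖v.1.1‖ ≤ mrNorm p j a b v := by
  have hw : 0 ≤ derivWeight a (b : EReal) := by rw [derivWeight_coe]; linarith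
  rw [mrNorm, ← Real.mul_rpow hw (norm_nonneg _)]
  exact le_rpow_sum (one_le_toReal hp) (norm_nonneg _) (norm_nonneg _)
    (mul_nonneg hw (norm_nonneg _))

theorem mrNorm_le (hp : p ≠ ⊤) (hab : a ≤ b) (v : MRSpace p j a b) :
    mrNorm p j a b v ≤ (‖j‖ + 1 + (b - a)) * ‖v.1‖ := by
  have hw : 0 ≤ derivWeight a (b : EReal) := by rw [derivWeight_coe]; linarith
  rw [mrNorm, ← Real.mul_rpow hw (norm_nonneg _)]
  refine (rpow_sum_le (one_le_toReal hp) (norm_nonneg _) (norm_nonneg _)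
    (mul_nonneg hw (norm_nonneg _))).trans ?_
  rw [derivWeight_coe]
  have h1 : ‖j.compLp v.1.1‖ ≤ ‖j‖ * ‖v.1.1‖ := j.norm_compLp_le _
  have h2 : ‖v.1.1‖ ≤ ‖v.1‖ := norm_fst_le _
  have h3 : ‖v.1.2‖ ≤ ‖v.1‖ := norm_snd_le _
  have h4 := mul_le_mul_of_nonneg_left h2 (norm_nonneg j)
  have h5 := mul_le_mul_of_nonneg_left h3 (sub_nonneg.2 hab)
  linarith

/-- Solutions are the elements of the zero trace space with the right image. -/
theorem isSolution_iff [CompleteSpace X]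
    (hab : a < b) {B : ℝ → D →L[ℝ] X} (hB : AEBddOp (timeMeasure a b) B)
    (f : Lp X p (timeMeasure a b)) (v : MRSpace p j a b) :
    IsSolution p j a b B f v ↔ v.1 ∈ zeroTraceSpace p j a b ∧ evolOp p hB v.1 = f := by
  have h1 : (∀ᵐ t ∂timeMeasure a b, v.1.2 t + B t (v.1.1 t) = f t) ↔ evolOp p hB v.1 = f := by
    constructor
    · intro h
      refine Lp.ext ?_
      filter_upwards [h, coeFn_evolOp hB v.1] with t e1 e2
      rw [e2, e1]
    · intro h
      filter_upwards [coeFn_evolOp hB v.1] with t e2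
      rw [← e2, h]
  rw [IsSolution, h1, and_comm]
  refine and_congr_left fun _ => ⟨fun h => ae_eq_primitive_of_zeroAtLeft v h, fun h => ?_⟩
  exact (exists_mrSpace_of_primitive hab v.1 h).2

/-- Every element of the zero trace space is the solution for its own image, so the maximal
regularity inequality applies to it. -/
theorem IsMRBound.norm_le [CompleteSpace X] (hp : p ≠ ⊤) (hab : a < b) {B : ℝ → D →L[ℝ] X}
    (hB : AEBddOp (timeMeasure a b) B) {K : ℝ≥0} (hK : IsMRBound p j a b B K)
    {z : Lp D p (timeMeasure a b) × Lp X p (timeMeasure a b)}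
    (hz : z ∈ zeroTraceSpace p j a b) : ‖z.1‖ ≤ K * ‖evolOp p hB z‖ := by
  obtain ⟨hm, -⟩ := exists_mrSpace_of_primitive hab z hz
  exact (norm_le_mrNorm hp hab.le ⟨z, hm⟩).trans
    (hK _ ⟨z, hm⟩ ((isSolution_iff hab hB _ _).2 ⟨hz, rfl⟩))

/-- Solvability on the half line gives solutions on a bounded interval, by translation and
extension by zero. -/
theorem exists_shifted_solution [CompleteSpace X]
    {C : D →L[ℝ] X} (hC : WellPosed p j 0 ⊤ (fun _ => C))
    (f : Lp X p (timeMeasure a b)) {h : ℝ} (hh : 0 ≤ h) (hf : VanishBefore (a + h) f) :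
    ∃ z ∈ zeroTraceSpace p j a b,
      evolOp p (AEBddOp.const (μ := timeMeasure a b) C) z = f ∧ VanishBefore (a + h) z.1 := by
  obtain ⟨F, hF, hFf⟩ : ∃ F : ℝ → X, MemLp F p volume ∧ ∀ t ∈ Ioo a b, F t = f t := by
    have h1 := Lp.memLp f
    generalize (f : ℝ → X) = f' at h1 ⊢
    rw [timeMeasure, timeInterval_coe] at h1
    exact ⟨(Ioo a b).indicator f', (memLp_indicator_iff_restrict measurableSet_Ioo).2 h1,
      fun t ht => indicator_of_mem ht _⟩
  have hg : MemLp (fun s => F (s + (a + h))) p (timeMeasure 0 ⊤) :=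
    (hF.comp_measurePreserving (measurePreserving_add_right volume (a + h))).restrict _
  obtain ⟨v, ⟨hv, hv0⟩, -⟩ := hC.1 hg.toLp
  have hprim := ae_eq_primitive_of_zeroAtLeft v hv0
  have hu := Lp.memLp v.1.1
  have hw := Lp.memLp v.1.2
  have heq : ∀ᵐ s ∂timeMeasure 0 ⊤, v.1.2 s + C (v.1.1 s) = F (s + (a + h)) := by
    filter_upwards [hv, hg.coeFn_toLp] with s h1 h2
    rw [h1, h2]
  generalize (v.1.1 : ℝ → D) = u₀ at hu hprim heq
  generalize (v.1.2 : ℝ → X) = w₀ at hw hprim heq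
  rw [timeMeasure, timeInterval_top] at hu hw hprim heq
  rw [ae_restrict_iff' measurableSet_Ioi] at hprim heq
  -- Extension by zero to negative times keeps `j u` the primitive of `w`, because the initial value
  -- is zero. The translate by `a + h` is the required solution.
  set u := (Ioi (0 : ℝ)).indicator u₀ with hudef
  set w := (Ioi (0 : ℝ)).indicator w₀ with hwdef
  have hu' : MemLp u p volume := (memLp_indicator_iff_restrict measurableSet_Ioi).2 hu
  have hw' : MemLp w p volume := (memLp_indicator_iff_restrict measurableSet_Ioi).2 hw
  have hu0 : ∀ s ≤ 0, u s = 0 := fun s hs => indicator_of_notMem (by simpa using hs) _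
  have hw0 : ∀ s ≤ 0, w s = 0 := fun s hs => indicator_of_notMem (by simpa using hs) _
  have hzero : ∀ r ≤ 0, ∫ s in r..0, w s = 0 := by
    intro r hr
    refine intervalIntegral.integral_zero_ae (Eventually.of_forall fun s hs => hw0 s ?_)
    rw [uIoc_of_le hr] at hs
    exact hs.2
  have hjuw : ∀ᵐ s, j (u s) = ∫ r in (0 : ℝ)..s, w r := by
    filter_upwards [hprim] with s hs
    rcases le_or_gt s 0 with h0 | h0
    · rw [hu0 s h0, intervalIntegral.integral_symm, hzero s h0]; simp
    · rw [hudef, indicator_of_mem (mem_Ioi.2 h0), hs h0]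
      refine intervalIntegral.integral_congr_ae (Eventually.of_forall fun r hr => ?_)
      rw [uIoc_of_le h0.le] at hr
      rw [hwdef, indicator_of_mem (mem_Ioi.2 hr.1)]
  have hint : ∀ x y, IntervalIntegrable w volume x y := fun x y =>
    
    ((hw'.locallyIntegrable Fact.out).integrableOn_isCompact isCompact_uIcc).intervalIntegrable
  have hmp := measurePreserving_sub_right (volume : Measure ℝ) (a + h)
  have hU : MemLp (fun t => u (t - (a + h))) p (timeMeasure a b) :=
    (hu'.comp_measurePreserving hmp).restrict _
  have hW : MemLp (fun t => w (t - (a + h))) p (timeMeasure a b) :=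
    (hw'.comp_measurePreserving hmp).restrict _
  refine ⟨(hU.toLp, hW.toLp), ?_, Lp.ext ?_, ?_⟩
  · filter_upwards [hU.coeFn_toLp, ae_restrict_of_ae (hmp.quasiMeasurePreserving.ae hjuw),
      ae_mem_timeInterval a b] with t h1 h2 ht
    rw [primitive_congr_ae hW.coeFn_toLp ht]
    rw [h1, h2, intervalIntegral.integral_comp_sub_right (fun s => w s),
      ← intervalIntegral.integral_add_adjacent_intervals (hint (a - (a + h)) 0) (hint 0 _),
      hzero _ (by linarith), zero_add]
  -- At `t = a + h` neither the equation nor the vanishing of `f` is available; this single time is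
  -- discarded.
  · have hne : ∀ᵐ t : ℝ, t ≠ a + h := by simp [ae_iff]
    filter_upwards [hU.coeFn_toLp, hW.coeFn_toLp,
      coeFn_evolOp (AEBddOp.const (μ := timeMeasure a b) C) (hU.toLp, hW.toLp),
      ae_restrict_of_ae (hmp.quasiMeasurePreserving.ae heq), ae_mem_timeInterval a b, hf,
      ae_restrict_of_ae hne] with t h1 h2 h3 h4 ht h5 h6
    rw [h3]
    rw [h1, h2]
    rcases lt_or_gt_of_ne h6 with h7 | h7
    · rw [hu0 _ (by linarith), hw0 _ (by linarith), h5 h7]; simp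
    · have h8 : t - (a + h) ∈ Ioi (0 : ℝ) := by simpa using h7
      rw [timeInterval_coe] at ht
      rw [hudef, hwdef, indicator_of_mem h8, indicator_of_mem h8, h4 h8, sub_add_cancel, hFf t ht]
  · filter_upwards [hU.coeFn_toLp] with t h1 ht
    rw [h1, hu0 _ (by linarith)]

/-- An operator with maximal regularity on the half line is causally solvable on a bounded
interval, with the bound given by any maximal regularity constant of that interval. -/
theorem exists_causalInverse_const [CompleteSpace X] (hp : p ≠ ⊤) (hab : a < b) {C : D →L[ℝ] X}
    (hC : WellPosed p j 0 ⊤ (fun _ => C)) {K : ℝ≥0} (hK : IsMRBound p j a b (fun _ => C) K) :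
    ∃ S, CausalInverse (p := p) j (AEBddOp.const (μ := timeMeasure a b) C) S ∧
      ∀ f, ‖(S f).1‖ ≤ K * ‖f‖ := by
  set hB := AEBddOp.const (μ := timeMeasure a b) C
  have hinj : ∀ z ∈ zeroTraceSpace p j a b, evolOp p hB z = 0 → z = 0 := by
    intro z hz h0
    have h1 := hK.norm_le hp hab hB hz
    rw [h0, norm_zero, mul_zero] at h1
    have h2 : z.1 = 0 := norm_le_zero_iff.1 h1
    have h3 : z.2 = 0 := by
      rw [evolOp_apply, h2, map_zero, add_zero] at h0; exact h0
    exact Prod.ext h2 h3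
  have huniq : ∀ z ∈ zeroTraceSpace p j a b, ∀ z' ∈ zeroTraceSpace p j a b,
      evolOp p hB z = evolOp p hB z' → z = z' := fun z hz z' hz' h =>
    sub_eq_zero.1 (hinj _ (sub_mem hz hz') (by rw [map_sub, h, sub_self]))
  have hex : ∀ f : Lp X p (timeMeasure a b), ∃ z ∈ zeroTraceSpace p j a b,
      evolOp p hB z = f := by
    intro f
    obtain ⟨z, h1, h2, -⟩ := exists_shifted_solution hC f le_rfl (by
      filter_upwards [ae_mem_timeInterval a b] with t ht ht'
      rw [add_zero] at ht'
      exact absurd ht.1 ht'.not_gt)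
    exact ⟨z, h1, h2⟩
  choose s hs hs' using hex
  have hbd : ∀ f, ‖(s f).1‖ ≤ K * ‖f‖ := fun f => by
    have := hK.norm_le hp hab hB (hs f)
    rwa [hs'] at this
  have hLp : ∀ u, ‖mulLp p hB u‖ ≤ ‖mulLp p hB‖ * ‖u‖ := (mulLp p hB).le_opNorm
  have hbd2 : ∀ f, ‖s f‖ ≤ (K + (1 + ‖mulLp p hB‖ * K)) * ‖f‖ := by
    intro f
    have h1 : (s f).2 = f - mulLp p hB (s f).1 := by
      rw [eq_sub_iff_add_eq, ← evolOp_apply, hs']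
    have h2 : ‖(s f).2‖ ≤ ‖f‖ + ‖mulLp p hB‖ * (K * ‖f‖) := by
      rw [h1]
      refine (norm_sub_le _ _).trans (add_le_add le_rfl ((hLp _).trans ?_))
      exact mul_le_mul_of_nonneg_left (hbd f) (norm_nonneg _)
    have h3 : 0 ≤ ‖mulLp p hB‖ * (K * ‖f‖) := by positivity
    have h4 : 0 ≤ K * ‖f‖ := by positivity
    refine norm_prod_le_iff.2 ⟨?_, ?_⟩
    · nlinarith [hbd f, norm_nonneg f]
    · nlinarith [norm_nonneg f]
  let S : Lp X p (timeMeasure a b) →L[ℝ] Lp D p (timeMeasure a b) × Lp X p (timeMeasure a b) :=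
    LinearMap.mkContinuous
      { toFun := s
        map_add' := fun f g => huniq _ (hs _) _ (add_mem (hs _) (hs _)) (by
          rw [map_add, hs', hs', hs'])
        map_smul' := fun c f => huniq _ (hs _) _ (Submodule.smul_mem _ c (hs _)) (by
          rw [map_smul, hs', hs']; rfl) } _ hbd2
  refine ⟨S, ⟨hs, hs', hinj, fun τ f hf => ?_⟩, hbd⟩
  change VanishBefore τ (s f).1
  -- For `a ≤ τ` the problem is solved from time `τ` on, and uniqueness identifies that solution
  -- with `s f`. For `τ < a` no time of the interval precedes `τ`.
  rcases le_or_gt a τ with h | h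
  · have e : a + (τ - a) = τ := by ring
    obtain ⟨z, h1, h2, h3⟩ := exists_shifted_solution hC f (sub_nonneg.2 h) (by rwa [e])
    rw [e] at h3
    rwa [huniq _ (hs f) _ h1 ((hs' f).trans h2.symm)]
  · filter_upwards [ae_mem_timeInterval a b] with t ht ht'
    exact absurd ht.1 (by linarith [ht.1])

end Autonomous

/-! ### Localisation in time and covering of the interval -/

section Covering

variable {X D : Type*} [NormedAddCommGroup X] [NormedSpace ℝ X]
  [NormedAddCommGroup D] [NormedSpace ℝ D]
  {p : ℝ≥0∞} [Fact (1 ≤ p)] {j : D →L[ℝ] X} {a b : ℝ}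

theorem isFiniteMeasure_timeMeasure (a b : ℝ) : IsFiniteMeasure (timeMeasure a b) := by
  rw [timeMeasure, timeInterval_coe]; infer_instance

theorem exists_integral_norm_le {E : Type*} [NormedAddCommGroup E] (μ : Measure ℝ)
    [IsFiniteMeasure μ] (p : ℝ≥0∞) [Fact (1 ≤ p)] :
    ∃ c : ℝ, 0 ≤ c ∧ ∀ w : Lp E p μ, ∫ t, ‖w t‖ ∂μ ≤ c * ‖w‖ := by
  have hfin : μ univ ^ (1 / (1 : ℝ≥0∞).toReal - 1 / p.toReal) ≠ ⊤ := by
    refine ENNReal.rpow_ne_top_of_nonneg ?_ (measure_ne_top μ _)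
    rw [ENNReal.toReal_one, div_one, sub_nonneg, one_div]
    rcases eq_or_ne p ⊤ with rfl | hp
    · simp
    · exact inv_le_one_of_one_le₀ (one_le_toReal hp)
  refine ⟨(μ univ ^ (1 / (1 : ℝ≥0∞).toReal - 1 / p.toReal)).toReal, ENNReal.toReal_nonneg,
    fun w => ?_⟩
  rw [integral_norm_eq_lintegral_enorm (Lp.aestronglyMeasurable w),
    ← eLpNorm_one_eq_lintegral_enorm, Lp.norm_def, mul_comm, ← ENNReal.toReal_mul]
  exact ENNReal.toReal_mono (ENNReal.mul_ne_top (Lp.eLpNorm_ne_top w) hfin)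
    (eLpNorm_le_eLpNorm_mul_rpow_measure_univ Fact.out (Lp.aestronglyMeasurable w))

/-- The primitive is bounded by the `L^1` norm of `u'`, and Hölder on the bounded interval passes to
`L^p`. This makes the lower order term `η‖j u‖` small on short intervals. -/
theorem exists_norm_le_of_zeroTrace [CompleteSpace X]
    (p : ℝ≥0∞) [Fact (1 ≤ p)] (j : D →L[ℝ] X) (a b : ℝ) :
    ∃ c : ℝ, 0 ≤ c ∧ ∀ z ∈ zeroTraceSpace p j a b,
      ∀ᵐ t ∂timeMeasure a b, ‖j (z.1 t)‖ ≤ c * ‖z.2‖ := by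
  have := isFiniteMeasure_timeMeasure a b
  obtain ⟨c, hc, h⟩ := exists_integral_norm_le (E := X) (timeMeasure a b) p
  refine ⟨c, hc, fun z hz => ?_⟩
  filter_upwards [hz, ae_mem_timeInterval a b] with t h1 ht
  rw [h1, intervalIntegral.integral_of_le ht.1.le]
  refine (norm_integral_le_integral_norm _).trans (le_trans ?_ (h z.2))
  refine integral_mono_measure (Measure.restrict_mono (Ioc_subset_timeInterval ht) le_rfl)
    (Eventually.of_forall fun _ => norm_nonneg _) ?_
  exact ((Lp.memLp z.2).integrable Fact.out).norm

theorem CausalInverse.congr {B C : ℝ → D →L[ℝ] X} {hB : AEBddOp (timeMeasure a b) B}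
    (hC : AEBddOp (timeMeasure a b) C) (hBC : ∀ᵐ t ∂timeMeasure a b, B t = C t)
    {S : Lp X p (timeMeasure a b) →L[ℝ] Lp D p (timeMeasure a b) × Lp X p (timeMeasure a b)}
    (h : CausalInverse j hB S) : CausalInverse j hC S := by
  have e : ∀ z, evolOp p hC z = evolOp p hB z := by
    intro z
    refine Lp.ext ?_
    filter_upwards [coeFn_evolOp hC z, coeFn_evolOp hB z, hBC] with t h1 h2 h3
    rw [h1, h2, h3]
  exact ⟨h.mem, fun f => (e _).trans (h.right_inv f),
    fun z hz h0 => h.inj z hz ((e z).symm.trans h0),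
    h.causal⟩

/-- Perturbation, on a short time interval, of a causally solvable operator. -/
theorem CausalInverse.exists_radius [CompleteSpace X] (hp : p ≠ ⊤) {C : D →L[ℝ] X}
    {S : Lp X p (timeMeasure a b) →L[ℝ] Lp D p (timeMeasure a b) × Lp X p (timeMeasure a b)}
    (h : CausalInverse j (AEBddOp.const (μ := timeMeasure a b) C) S) {K ε η : ℝ}
    (hK : ∀ f, ‖(S f).1‖ ≤ K * ‖f‖) (hε : 0 ≤ ε) (hεK : ε * K ≤ 1 / 4) (hη : 0 ≤ η) :
    ∃ δ > 0, ∀ B : ℝ → D →L[ℝ] X, AEBddOp (timeMeasure a b) B → ∀ σ τ : ℝ, τ - σ ≤ δ →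
      (∀ᵐ t ∂timeMeasure a b, t ∈ Ico σ τ → ∀ x, ‖B t x - C x‖ ≤ ε * ‖x‖ + η * ‖j x‖) →
      ∃ B', ∃ hB' : AEBddOp (timeMeasure a b) B', ∃ T,
        CausalInverse (p := p) j hB' T ∧ ∀ t ∈ Ico σ τ, B' t = B t := by
  classical
  obtain ⟨c, hc, htr⟩ := exists_norm_le_of_zeroTrace p j a b
  set M := η * (c * ‖S‖) with hM
  have hM0 : 0 ≤ M := by positivity
  have hq : 0 < p.toReal := lt_of_lt_of_le one_pos (one_le_toReal hp)
  have hpos : 0 < 1 / 4 / (M + 1) := by positivity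
  -- Chosen so that `M δ^(1/p) ≤ 1/4`. The `ε` and `η` terms then contribute `1/4` each, and the
  -- perturbation has norm at most `1/2`.
  refine ⟨(1 / 4 / (M + 1)) ^ p.toReal, Real.rpow_pos_of_pos hpos _, ?_⟩
  intro B hB σ τ hδ hloc
  have hB' : AEBddOp (timeMeasure a b) (fun t => if t ∈ Ico σ τ then B t else C) :=
    hB.ite (AEBddOp.const C) measurableSet_Ico
  obtain ⟨T, hT⟩ := h.perturb (hB := hB') (c := 1 / 2) (by norm_num) (by norm_num) (by
    intro f
    have := isFiniteMeasure_timeMeasure a b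
    set z := S f
    have hn := (Lp.memLp z.1).norm
    have hμs : timeMeasure a b (Ico σ τ) ≠ ⊤ := measure_ne_top _ _
    -- The pointwise majorant is `ε‖u‖ + η c ‖u'‖_p` with the second term supported on `[σ, τ)`,
    -- whose `L^p` norm carries the factor `(τ - σ)^(1/p)`.
    have hr : ‖mulLp p hB' z.1 - mulLp p (AEBddOp.const (μ := timeMeasure a b) C) z.1‖
        ≤ ‖ε • hn.toLp + indicatorConstLp p measurableSet_Ico hμs (η * (c * ‖z.2‖))‖ := by
      refine Lp.norm_le_norm_of_ae_le ?_
      filter_upwards [coeFn_mulLp hB' z.1, coeFn_mulLp (AEBddOp.const (μ := timeMeasure a b) C) z.1,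
        Lp.coeFn_sub (mulLp p hB' z.1) (mulLp p (AEBddOp.const (μ := timeMeasure a b) C) z.1),
        Lp.coeFn_add (ε • hn.toLp) (indicatorConstLp p measurableSet_Ico hμs (η * (c * ‖z.2‖))),
        Lp.coeFn_smul ε hn.toLp, hn.coeFn_toLp,
        indicatorConstLp_coeFn (p := p) (hs := measurableSet_Ico) (hμs := hμs)
          (c := η * (c * ‖z.2‖)), htr z (h.mem f), hloc] with t h1 h2 h3 h4 h5 h6 h7 h8 h9
      rw [h3, h4, Pi.sub_apply, Pi.add_apply, h1, h2, h5, h7, Pi.smul_apply, h6, smul_eq_mul]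
      refine le_trans ?_ (Real.le_norm_self _)
      by_cases ht : t ∈ Ico σ τ
      · rw [if_pos ht, indicator_of_mem ht]
        exact (h9 ht _).trans (add_le_add le_rfl (mul_le_mul_of_nonneg_left h8 hη))
      · rw [if_neg ht, indicator_of_notMem ht, sub_self, norm_zero]
        positivity
    refine hr.trans ((norm_add_le _ _).trans ?_)
    have e1 : ‖ε • hn.toLp‖ ≤ 1 / 4 * ‖f‖ := by
      rw [norm_smul, Lp.norm_toLp, eLpNorm_norm, ← Lp.norm_def, Real.norm_of_nonneg hε]
      calc ε * ‖z.1‖ ≤ ε * (K * ‖f‖) := mul_le_mul_of_nonneg_left (hK f) hε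
        _ = ε * K * ‖f‖ := by ring
        _ ≤ _ := mul_le_mul_of_nonneg_right hεK (norm_nonneg _)
    have e2 : (timeMeasure a b).real (Ico σ τ) ^ (1 / p.toReal) ≤ 1 / 4 / (M + 1) := by
      have hle : (timeMeasure a b).real (Ico σ τ) ≤ (1 / 4 / (M + 1)) ^ p.toReal := by
        have h1 : timeMeasure a b (Ico σ τ) ≤ volume (Ico σ τ) := Measure.restrict_apply_le _ _
        rw [Real.volume_Ico] at h1
        refine ENNReal.toReal_le_of_le_ofReal (by positivity) (h1.trans ?_)
        exact ENNReal.ofReal_le_ofReal hδ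
      refine (Real.rpow_le_rpow measureReal_nonneg hle (by positivity)).trans ?_
      rw [← Real.rpow_mul hpos.le, mul_one_div_cancel hq.ne', Real.rpow_one]
    have e3 : ‖indicatorConstLp p measurableSet_Ico hμs (η * (c * ‖z.2‖))‖ ≤ 1 / 4 * ‖f‖ := by
      refine norm_indicatorConstLp_le.trans ?_
      rw [Real.norm_of_nonneg (by positivity)]
      have hz2 : ‖z.2‖ ≤ ‖S‖ * ‖f‖ := (norm_snd_le z).trans (S.le_opNorm f)
      calc η * (c * ‖z.2‖) * (timeMeasure a b).real (Ico σ τ) ^ (1 / p.toReal)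
          ≤ η * (c * (‖S‖ * ‖f‖)) * (1 / 4 / (M + 1)) := by gcongr
        _ = M / (M + 1) * (1 / 4 * ‖f‖) := by rw [hM]; ring
        _ ≤ 1 * (1 / 4 * ‖f‖) := by
            refine mul_le_mul_of_nonneg_right ?_ (by positivity)
            rw [div_le_one (by positivity)]; linarith
        _ = _ := one_mul _
    linarith)
  exact ⟨_, hB', T, hT, fun t ht => if_pos ht⟩

/-- A nonautonomous operator that is locally a relatively small perturbation of autonomous operators
with maximal regularity is causally solvable. -/
theorem exists_causalInverse_of_local [CompleteSpace X]
    (hp : p ≠ ⊤) (hab : a < b) {B : ℝ → D →L[ℝ] X}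
    (hB : AEBddOp (timeMeasure a b) B)
    (hloc : ∀ s ∈ Icc a b, ∃ C : D →L[ℝ] X, WellPosed p j 0 ⊤ (fun _ => C) ∧
      ∃ K : ℝ≥0, IsMRBound p j a b (fun _ => C) K ∧ ∃ ε δ η : ℝ, 0 ≤ ε ∧ ε * K ≤ 1 / 4 ∧ 0 < δ ∧
        0 ≤ η ∧ ∀ᵐ t ∂timeMeasure a b, |t - s| ≤ δ →
          ∀ x, ‖B t x - C x‖ ≤ ε * ‖x‖ + η * ‖j x‖) :
    ∃ T, CausalInverse (p := p) j hB T := by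
  classical
  have hrad : ∀ s : Icc a b, ∃ r > 0, ∀ σ τ : ℝ, |σ - s| < r → |τ - s| < r →
      ∃ B', ∃ hB' : AEBddOp (timeMeasure a b) B', ∃ T,
        CausalInverse (p := p) j hB' T ∧ ∀ t ∈ Ico σ τ, B' t = B t := by
    rintro ⟨s, hs⟩
    obtain ⟨C, hC, K, hK, ε, δ, η, hε, hεK, hδ, hη, hest⟩ := hloc s hs
    obtain ⟨S, hS, hSK⟩ := exists_causalInverse_const hp hab hC hK
    obtain ⟨δ', hδ', H⟩ := hS.exists_radius hp hSK hε hεK hη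
    refine ⟨min δ (δ' / 2), by positivity, fun σ τ h1 h2 => H B hB σ τ ?_ ?_⟩
    · have h3 := abs_lt.1 (h1.trans_le (min_le_right _ _))
      have h4 := abs_lt.1 (h2.trans_le (min_le_right _ _))
      linarith [h3.1, h4.2]
    · filter_upwards [hest] with t ht htm
      have h3 := abs_lt.1 (h1.trans_le (min_le_left _ _))
      have h4 := abs_lt.1 (h2.trans_le (min_le_left _ _))
      exact ht (abs_le.2 ⟨by linarith [h3.1, htm.1], by linarith [h4.2, htm.2]⟩)
  choose r hr H using hrad
  obtain ⟨t, ht0, hmono, ⟨m, hm⟩, hsub⟩ := exists_monotone_Icc_subset_open_cover_Icc hab.le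
    (c := fun s : Icc a b => Metric.ball s (r s)) (fun _ => Metric.isOpen_ball)
    (fun s _ => mem_iUnion.2 ⟨s, Metric.mem_ball_self (hr s)⟩)
  have hstep : ∀ n, ∃ B', ∃ hB' : AEBddOp (timeMeasure a b) B', ∃ T,
        CausalInverse (p := p) j hB' T ∧ ∀ s ∈ Ico (t n : ℝ) (t (n + 1)), B' s = B s := by
    intro n
    obtain ⟨s, hs⟩ := hsub n
    exact H s _ _ (hs ⟨le_rfl, hmono n.le_succ⟩) (hs ⟨hmono n.le_succ, le_rfl⟩)
  -- The auxiliary operator agrees with `B` only up to `t n`; what it is afterwards is irrelevant,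
  -- since the next step switches it off there.
  have hind : ∀ n, ∃ B', ∃ hB' : AEBddOp (timeMeasure a b) B', ∃ T,
        CausalInverse (p := p) j hB' T ∧ ∀ s, a < s → s < t n → B' s = B s := by
    intro n
    induction n with
    | zero =>
      obtain ⟨B', hB', T, hT, -⟩ := hstep 0
      exact ⟨B', hB', T, hT, fun s h1 h2 => absurd h1 (by rw [ht0] at h2; exact h2.not_gt)⟩
    | succ n ih =>
      obtain ⟨B₁, hB₁, T₁, hT₁, h₁⟩ := ih
      obtain ⟨B₂, hB₂, T₂, hT₂, h₂⟩ := hstep n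
      obtain ⟨T, hT⟩ := hT₁.switch hT₂ (t n)
      refine ⟨_, _, T, hT, fun s hs hs' => ?_⟩
      by_cases hsn : s < t n
      · rw [if_pos (mem_Iio.2 hsn), h₁ s hs hsn]
      · rw [if_neg (by simpa using hsn), h₂ s ⟨not_lt.1 hsn, hs'⟩]
  obtain ⟨B', hB', T, hT, h⟩ := hind m
  refine ⟨T, hT.congr hB ?_⟩
  filter_upwards [ae_mem_timeInterval a b] with s hs
  rw [timeInterval_coe] at hs
  exact h s hs.1 (by rw [hm m le_rfl]; exact hs.2)

end Covering

/-! ### Graph norms, uniform limits and weak convergence -/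

section Conclusion

variable {X D : Type*} [NormedAddCommGroup X] [NormedSpace ℝ X]
  [NormedAddCommGroup D] [NormedSpace ℝ D]
  {p : ℝ≥0∞} [Fact (1 ≤ p)] {j : D →L[ℝ] X} {a b : ℝ}

theorem CausalInverse.wellPosed [CompleteSpace X] (hp : p ≠ ⊤) (hab : a < b) {B : ℝ → D →L[ℝ] X}
    {hB : AEBddOp (timeMeasure a b) B}
    {S : Lp X p (timeMeasure a b) →L[ℝ] Lp D p (timeMeasure a b) × Lp X p (timeMeasure a b)}
    (h : CausalInverse j hB S) : WellPosed p j a b B := by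
  refine ⟨fun f => ?_, (‖j‖₊ + 1 + (b - a).toNNReal) * ‖S‖₊, fun f v hv => ?_⟩
  · obtain ⟨hm, -⟩ := exists_mrSpace_of_primitive hab (S f) (h.mem f)
    refine ⟨⟨S f, hm⟩, (isSolution_iff hab hB _ _).2 ⟨h.mem f, h.right_inv f⟩, fun v hv => ?_⟩
    obtain ⟨h1, h2⟩ := (isSolution_iff hab hB _ _).1 hv
    exact Subtype.ext (by rw [← h.left_inv h1, h2])
  · obtain ⟨h1, h2⟩ := (isSolution_iff hab hB _ _).1 hv
    refine (mrNorm_le hp hab.le v).trans ?_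
    have h3 : ‖v.1‖ ≤ ‖S‖ * ‖f‖ := by
      rw [← h.left_inv h1, h2]; exact S.le_opNorm f
    have h4 : 0 ≤ b - a := sub_nonneg.2 hab.le
    push_cast
    rw [Real.coe_toNNReal _ h4, mul_assoc]
    exact mul_le_mul_of_nonneg_left h3 (by positivity)

/-- A maximal regularity bound controls the norm of `D` by the graph norm, uniformly. -/
theorem exists_graph_bound [CompleteSpace X] (hp : p ≠ ⊤) (hab : a < b) :
    ∃ c : ℝ, 0 ≤ c ∧ ∀ (C : D →L[ℝ] X) (K : ℝ≥0), IsMRBound p j a b (fun _ => C) K →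
      ∀ x, ‖x‖ ≤ K * (c * ‖j x‖ + ‖C x‖) := by
  have := isFiniteMeasure_timeMeasure a b
  have hθ : MemLp (fun t : ℝ => t - a) p (timeMeasure a b) := by
    refine MemLp.of_bound (by fun_prop) (b - a) ?_
    filter_upwards [ae_mem_timeInterval a b] with t ht
    rw [timeInterval_coe] at ht
    rw [Real.norm_of_nonneg (by linarith [ht.1])]
    linarith [ht.2]
  set θ := hθ.toLp with hθdef
  have hN : 0 < ‖θ‖ := by
    rw [norm_pos_iff]
    intro h0
    have h1 : ∀ᵐ t ∂timeMeasure a b, False := by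
      filter_upwards [hθ.coeFn_toLp, (Lp.eq_zero_iff_ae_eq_zero).1 h0,
        ae_mem_timeInterval a b] with t h1 h2 h3
      rw [← hθdef, h2, Pi.zero_apply] at h1
      linarith [h3.1]
    rw [ae_iff] at h1
    simp only [not_false_eq_true] at h1
    change timeMeasure a b univ = 0 at h1
    rw [timeMeasure, timeInterval_coe, Measure.restrict_apply_univ, Real.volume_Ioo,
      ENNReal.ofReal_eq_zero] at h1
    linarith
  set κ := (memLp_const (1 : ℝ) : MemLp (fun _ => (1 : ℝ)) p (timeMeasure a b)).toLp with hκ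
  refine ⟨‖κ‖ / ‖θ‖, by positivity, fun C K hK x => ?_⟩
  -- The inequality is tested on `u(t) = (t - a) x`, with `u' = j x` and `u' + C u = j x + (t - a) C
  -- x`; dividing by the `L^p` norm of `t - a` gives the constant.
  have hu : MemLp (fun t : ℝ => (t - a) • x) p (timeMeasure a b) :=
    (ContinuousLinearMap.toSpanSingleton ℝ x).comp_memLp' hθ
  have hw : MemLp (fun _ : ℝ => j x) p (timeMeasure a b) := memLp_const _
  have hz : (hu.toLp, hw.toLp) ∈ zeroTraceSpace p j a b := by
    change ∀ᵐ t ∂timeMeasure a b, 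
      j ((hu.toLp : Lp D p (timeMeasure a b)) t)
        = ∫ s in a..t, (hw.toLp : Lp X p (timeMeasure a b)) s
    filter_upwards [hu.coeFn_toLp, ae_mem_timeInterval a b] with t h1 h2
    rw [primitive_congr_ae hw.coeFn_toLp h2, h1, map_smul, intervalIntegral.integral_const]
  set hB := AEBddOp.const (μ := timeMeasure a b) C
  have hbd := hK.norm_le hp hab hB hz
  have e1 : ‖θ‖ * ‖x‖ ≤ ‖hu.toLp‖ := by
    have : ‖(‖x‖ • θ : Lp ℝ p (timeMeasure a b))‖ ≤ ‖hu.toLp‖ := by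
      refine Lp.norm_le_norm_of_ae_le ?_
      filter_upwards [hu.coeFn_toLp, hθ.coeFn_toLp, Lp.coeFn_smul ‖x‖ θ] with t h1 h2 h3
      rw [h3, Pi.smul_apply, h2, h1, norm_smul, norm_smul, norm_norm, mul_comm]
    rwa [norm_smul, norm_norm, mul_comm] at this
  have e2 : ‖mulLp p hB hu.toLp‖ ≤ ‖C x‖ * ‖θ‖ := by
    refine Lp.norm_le_mul_norm_of_ae_le_mul ?_
    filter_upwards [coeFn_mulLp hB hu.toLp, hu.coeFn_toLp, hθ.coeFn_toLp] with t h1 h2 h3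
    rw [h1, h2, h3, map_smul, norm_smul, mul_comm]
  have e3 : ‖hw.toLp‖ ≤ ‖j x‖ * ‖κ‖ := by
    refine Lp.norm_le_mul_norm_of_ae_le_mul ?_
    filter_upwards [hw.coeFn_toLp,
      (memLp_const (1 : ℝ) : MemLp (fun _ => (1 : ℝ)) p (timeMeasure a b)).coeFn_toLp] with t h1 h2
    rw [h1, hκ, h2]; simp
  have e4 : ‖evolOp p hB (hu.toLp, hw.toLp)‖ ≤ ‖j x‖ * ‖κ‖ + ‖C x‖ * ‖θ‖ :=
    (norm_add_le _ _).trans (add_le_add e3 e2)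
  have e5 : ‖θ‖ * ‖x‖ ≤ K * (‖j x‖ * ‖κ‖ + ‖C x‖ * ‖θ‖) :=
    e1.trans (hbd.trans (mul_le_mul_of_nonneg_left e4 K.2))
  rw [← mul_le_mul_iff_right₀ hN]
  refine e5.trans (le_of_eq ?_)
  field_simp

theorem GraphNormEquiv.of_le {C : D →L[ℝ] X} {K c : ℝ} (hK : 0 ≤ K) (hc : 0 ≤ c)
    (h : ∀ x, ‖x‖ ≤ K * (c * ‖j x‖ + ‖C x‖)) : GraphNormEquiv j C := by
  have hM : 0 < K * (c + 1) + 1 := by positivity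
  refine ⟨(K * (c + 1) + 1)⁻¹, ‖j‖ + ‖C‖ + 1, by positivity, by positivity, fun x => ⟨?_, ?_⟩⟩
  · rw [inv_mul_le_iff₀ hM]
    refine (h x).trans ?_
    have h1 : c * ‖j x‖ + ‖C x‖ ≤ (c + 1) * (‖j x‖ + ‖C x‖) := by
      nlinarith [norm_nonneg (j x), norm_nonneg (C x), mul_nonneg hc (norm_nonneg (C x))]
    have h2 := mul_le_mul_of_nonneg_left h1 hK
    nlinarith [norm_nonneg (j x), norm_nonneg (C x)]
  · nlinarith [j.le_opNorm x, C.le_opNorm x, norm_nonneg x]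

/-- The lower bound is a closed condition, as `K` and `c` do not depend on the index. -/
theorem GraphNormEquiv.of_tendsto {ι : Type*} {F : Filter ι} [F.NeBot] {C : ι → D →L[ℝ] X}
    {C₀ : D →L[ℝ] X} (hC : Tendsto C F (𝓝 C₀)) {K c : ℝ} (hK : 0 ≤ K) (hc : 0 ≤ c)
    (h : ∀ᶠ i in F, ∀ x, ‖x‖ ≤ K * (c * ‖j x‖ + ‖C i x‖)) : GraphNormEquiv j C₀ := by
  refine GraphNormEquiv.of_le hK hc fun x => ?_
  have h1 : Tendsto (fun i => C i x) F (𝓝 (C₀ x)) :=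
    ((ContinuousLinearMap.apply ℝ X x).continuous.tendsto C₀).comp hC
  exact ge_of_tendsto ((h1.norm.const_add (c * ‖j x‖)).const_mul K)
    (h.mono fun i hi => hi x)

/-- Relative continuity with `ε = 1` bounds the oscillation by `1 + η‖j‖` on balls of radius `δ`,
and finitely many of these cover the interval. -/
theorem RelCont.aeBddOp {B : ℝ → D →L[ℝ] X} (hB : RelCont j a b B) :
    AEBddOp (timeMeasure a b) B := by
  refine ⟨hB.1, ?_⟩
  obtain ⟨δ, η, hδ, hη, h⟩ := hB.2 1 one_pos
  obtain ⟨s, hs, hcov⟩ := (isCompact_Icc (a := a) (b := b)).elim_nhds_subcover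
    (fun t => Metric.ball t δ) fun t _ => Metric.ball_mem_nhds t hδ
  refine ⟨∑ t ∈ s, ‖B t‖ + (1 + η * ‖j‖), ?_⟩
  filter_upwards [ae_mem_timeInterval a b] with t ht
  rw [timeInterval_coe] at ht
  have htI := Ioo_subset_Icc_self ht
  obtain ⟨r, hr, htr⟩ := mem_iUnion₂.1 (hcov htI)
  have h1 : ‖B t - B r‖ ≤ 1 + η * ‖j‖ := by
    refine ContinuousLinearMap.opNorm_le_bound _ (by positivity) fun x => ?_
    refine (h x t htI r (hs r hr) (le_of_lt htr)).trans ?_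
    have := mul_le_mul_of_nonneg_left (j.le_opNorm x) hη
    linarith
  have h2 : ‖B r‖ ≤ ∑ t ∈ s, ‖B t‖ :=
    Finset.single_le_sum (f := fun t => ‖B t‖) (fun _ _ => norm_nonneg _) hr
  calc ‖B t‖ = ‖B r + (B t - B r)‖ := by rw [add_sub_cancel]
    _ ≤ _ := (norm_add_le _ _).trans (add_le_add h2 h1)

theorem AEBddOp.memLInfty {B : ℝ → D →L[ℝ] X} (hB : AEBddOp (timeMeasure a b) B) :
    MemLInfty a b B := by
  intro x
  obtain ⟨L, hL⟩ := hB.bdd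
  refine memLp_top_of_bound (hB.meas x) (L * ‖x‖) ?_
  filter_upwards [hL] with t ht
  exact (B t).le_of_opNorm_le ht x

theorem ae_norm_sub_le_distInfty {A B : ℝ → D →L[ℝ] X} (h : distInfty a b A B ≠ ⊤) :
    ∀ᵐ t ∂timeMeasure a b, ‖A t - B t‖ ≤ (distInfty a b A B).toReal := by
  filter_upwards [ENNReal.ae_le_essSup (μ := timeMeasure a b) fun t => ‖A t - B t‖ₑ] with t ht
  rw [← toReal_enorm]
  exact ENNReal.toReal_mono h ht

theorem AEBddOp.of_tendsto {B : ℝ → D →L[ℝ] X} {C : ℕ → ℝ → D →L[ℝ] X} {μ : Measure ℝ}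
    (hC : ∀ n, AEBddOp μ (C n)) {d : ℕ → ℝ} (hd : Tendsto d atTop (𝓝 0))
    (h : ∀ n, ∀ᵐ t ∂μ, ‖C n t - B t‖ ≤ d n) :
    AEBddOp μ B ∧ ∀ᵐ t ∂μ, Tendsto (fun n => C n t) atTop (𝓝 (B t)) := by
  have hlim : ∀ᵐ t ∂μ, Tendsto (fun n => C n t) atTop (𝓝 (B t)) := by
    filter_upwards [ae_all_iff.2 h] with t ht
    exact tendsto_iff_norm_sub_tendsto_zero.2
      (squeeze_zero (fun _ => norm_nonneg _) ht hd)
  refine ⟨⟨fun x => ?_, ?_⟩, hlim⟩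
  · refine aestronglyMeasurable_of_tendsto_ae atTop (fun n => (hC n).meas x) ?_
    filter_upwards [hlim] with t ht
    exact ((ContinuousLinearMap.apply ℝ X x).continuous.tendsto (B t)).comp ht
  · obtain ⟨L, hL⟩ := (hC 0).bdd
    refine ⟨L + d 0, ?_⟩
    filter_upwards [hL, h 0] with t h1 h2
    calc ‖B t‖ = ‖C 0 t - (C 0 t - B t)‖ := by rw [sub_sub_cancel]
      _ ≤ _ := (norm_sub_le _ _).trans (add_le_add h1 h2)

theorem IsMRBound.mono {B : ℝ → D →L[ℝ] X} {K K' : ℝ≥0} (h : IsMRBound p j a b B K)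
    (hK : K ≤ K') : IsMRBound p j a b B K' := fun f v hv =>
  (h f v hv).trans (mul_le_mul_of_nonneg_right (NNReal.coe_le_coe.2 hK) (norm_nonneg _))

theorem exists_uniform_mrBound {Λ : Type*} {O : Set Λ} {C : Λ → D →L[ℝ] X}
    (h : ⨆ l ∈ O, mrConst p j a b (fun _ => C l) < ⊤) :
    ∃ K : ℝ≥0, ∀ l ∈ O, IsMRBound p j a b (fun _ => C l) K := by
  set M := ⨆ l ∈ O, mrConst p j a b (fun _ => C l)
  -- The infimum need not be known to be attained, so a strictly larger number is taken. Finiteness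
  -- also ensures that an admissible constant exists, the infimum over none being `⊤`.
  refine ⟨M.toNNReal + 1, fun l hl => ?_⟩
  have h1 : mrConst p j a b (fun _ => C l) ≤ M :=
    le_iSup₂ (f := fun l (_ : l ∈ O) => mrConst p j a b (fun _ => C l)) l hl
  have h2 : mrConst p j a b (fun _ => C l) < ((M.toNNReal + 1 : ℝ≥0) : ℝ≥0∞) := by
    rw [ENNReal.coe_add, ENNReal.coe_toNNReal h.ne]
    exact h1.trans_lt (ENNReal.lt_add_right h.ne (by simp))
  obtain ⟨K, hK⟩ := iInf_lt_iff.1 h2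
  obtain ⟨hb, hlt⟩ := iInf_lt_iff.1 hK
  exact hb.mono (ENNReal.coe_lt_coe.1 hlt).le

/-- Causal solvability of a uniform limit of relatively continuous families of operators with
uniform maximal regularity. -/
theorem exists_causalInverse_of_approx [CompleteSpace X]
    (hp : p ≠ ⊤) (hab : a < b) {Λ : Type*} {O : Set Λ}
    {A : Λ → ℝ → D →L[ℝ] X} (hA_rc : ∀ l ∈ O, RelCont j a b (A l))
    (hA_mr : ∀ t ∈ Icc a b, ∀ l ∈ O, WellPosed p j 0 ⊤ (fun _ => A l t))
    (hA_sup : ∀ t ∈ Icc a b, ⨆ l ∈ O, mrConst p j a b (fun _ => A l t) < ⊤)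
    {B : ℝ → D →L[ℝ] X} (hB : AEBddOp (timeMeasure a b) B)
    (hBA : ∀ ε > 0, ∃ l ∈ O, ∀ᵐ t ∂timeMeasure a b, ‖A l t - B t‖ ≤ ε) :
    ∃ T, CausalInverse (p := p) j hB T := by
  refine exists_causalInverse_of_local hp hab hB fun s hs => ?_
  -- `K` serves all parameters at time `s`, so `ε` is fixed before `l` is chosen; half of `ε` goes
  -- to the distance to `B`, half to the oscillation of `A l`.
  obtain ⟨K, hK⟩ := exists_uniform_mrBound (hA_sup s hs)
  set ε : ℝ := 1 / (4 * (K + 1)) with hε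
  have hε0 : 0 < ε := by positivity
  have hεK : ε * K ≤ 1 / 4 := by
    rw [hε, div_mul_eq_mul_div, one_mul, div_le_div_iff₀ (by positivity) (by norm_num)]
    linarith
  obtain ⟨l, hl, hBl⟩ := hBA (ε / 2) (by positivity)
  obtain ⟨δ, η, hδ, hη, hrc⟩ := (hA_rc l hl).2 (ε / 2) (by positivity)
  refine ⟨A l s, hA_mr s hs l hl, K, hK l hl, ε, δ, η, hε0.le, hεK, hδ, hη, ?_⟩
  filter_upwards [hBl, ae_mem_timeInterval a b] with t h1 ht hts x
  rw [timeInterval_coe] at ht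
  have h2 := hrc x t (Ioo_subset_Icc_self ht) s hs hts
  have h3 := (A l t - B t).le_of_opNorm_le h1 x
  calc ‖B t x - A l s x‖ = ‖(A l t x - A l s x) - (A l t - B t) x‖ := by
        congr 1; rw [sub_apply]; abel
    _ ≤ _ := norm_sub_le _ _
    _ ≤ _ := by linarith

/-- Uniform boundedness in the bidual. It is stated for sequences, since boundedness can fail along
a general filter. -/
theorem exists_norm_le_of_weakTendsto {E : Type*} [NormedAddCommGroup E] [NormedSpace ℝ E]
    {f : ℕ → E} {g : E} (h : ∀ φ : E →L[ℝ] ℝ, Tendsto (fun n => φ (f n)) atTop (𝓝 (φ g))) :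
    ∃ R, ∀ n, ‖f n‖ ≤ R := by
  obtain ⟨R, hR⟩ := banach_steinhaus
    (g := fun n => NormedSpace.inclusionInDoubleDualLi ℝ (f n)) (fun φ => by
      obtain ⟨C, hC⟩ := (Metric.isBounded_range_of_tendsto _ (h φ)).exists_norm_le
      exact ⟨C, fun n => hC _ (mem_range_self n)⟩)
  exact ⟨R, fun n => ((NormedSpace.inclusionInDoubleDualLi ℝ).norm_map (f n)).symm.trans_le (hR n)⟩

/-- Weak convergence of the solutions. -/
theorem CausalInverse.weakTendstoMR [CompleteSpace X]
    (hp : p ≠ ⊤) (hab : a < b) {B₀ : ℝ → D →L[ℝ] X}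
    {hB₀ : AEBddOp (timeMeasure a b) B₀}
    {S : Lp X p (timeMeasure a b) →L[ℝ] Lp D p (timeMeasure a b) × Lp X p (timeMeasure a b)}
    (hS : CausalInverse j hB₀ S) {ι : Type*} {F : Filter ι} [F.IsCountablyGenerated]
    {B : ι → ℝ → D →L[ℝ] X} {d : ι → ℝ} (hd : Tendsto d F (𝓝 0))
    (hB : ∀ᶠ i in F, AEBddOp (timeMeasure a b) (B i))
    (hBd : ∀ᶠ i in F, ∀ᵐ t ∂timeMeasure a b, ‖B i t - B₀ t‖ ≤ d i)
    {f : ι → Lp X p (timeMeasure a b)} {f₀ : Lp X p (timeMeasure a b)}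
    {v : ι → MRSpace p j a b} {v₀ : MRSpace p j a b}
    (hf : WeakTendstoLp p a b f F f₀)
    (hv : ∀ᶠ i in F, IsSolution p j a b (B i) (f i) (v i))
    (hv₀ : IsSolution p j a b B₀ f₀ v₀) : WeakTendstoMR p j a b v F v₀ := by
  rintro φ ⟨C, hC⟩
  have hmem : ∀ g, S g ∈ MRSpace p j a b := fun g =>
    (exists_mrSpace_of_primitive hab (S g) (hS.mem g)).1
  let ψ : Lp X p (timeMeasure a b) →L[ℝ] ℝ :=
    LinearMap.mkContinuous (φ.comp (S.toLinearMap.codRestrict (MRSpace p j a b) hmem))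
      (|C| * ((‖j‖ + 1 + (b - a)) * ‖S‖)) (fun g => by
        have hba := sub_nonneg.2 hab.le
        have h1 : mrNorm p j a b ⟨S g, hmem g⟩ ≤ (‖j‖ + 1 + (b - a)) * (‖S‖ * ‖g‖) :=
          (mrNorm_le hp hab.le _).trans
            (mul_le_mul_of_nonneg_left (S.le_opNorm g) (by positivity))
        have h0 : 0 ≤ mrNorm p j a b ⟨S g, hmem g⟩ :=
          (norm_nonneg _).trans (norm_le_mrNorm hp hab.le _)
        calc ‖φ ⟨S g, hmem g⟩‖ ≤ C * mrNorm p j a b ⟨S g, hmem g⟩ := hC _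
          _ ≤ |C| * mrNorm p j a b ⟨S g, hmem g⟩ :=
            mul_le_mul_of_nonneg_right (le_abs_self C) h0
          _ ≤ |C| * ((‖j‖ + 1 + (b - a)) * (‖S‖ * ‖g‖)) :=
            mul_le_mul_of_nonneg_left h1 (abs_nonneg C)
          _ = _ := by ring)
  have hψ : ∀ w : MRSpace p j a b, w.1 ∈ zeroTraceSpace p j a b →
      φ w = ψ (evolOp p hB₀ w.1) := by
    intro w hw
    change φ w = φ ⟨S (evolOp p hB₀ w.1), hmem _⟩
    exact congrArg φ (Subtype.ext (hS.left_inv hw).symm)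
  obtain ⟨hz₀, hev₀⟩ := (isSolution_iff hab hB₀ _ _).1 hv₀
  -- The residual of `v i` in the limit equation equals `(B₀ - B i)` applied to `v i`.
  let e : ι → Lp X p (timeMeasure a b) := fun i => evolOp p hB₀ (v i).1 - f i
  have hez : ∀ᶠ i in F, (v i).1 ∈ zeroTraceSpace p j a b ∧ ‖e i‖ ≤ d i * ‖(v i).1.1‖ := by
    filter_upwards [hB, hBd, hv] with i h1 h2 h3
    obtain ⟨h4, h5⟩ := (isSolution_iff hab h1 _ _).1 h3
    refine ⟨h4, Lp.norm_le_mul_norm_of_ae_le_mul ?_⟩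
    filter_upwards [Lp.coeFn_sub (evolOp p hB₀ (v i).1) (f i), coeFn_evolOp hB₀ (v i).1, h2,
      h3.1] with t e1 e2 e3 e4
    have e5 : e i t = -((B i t - B₀ t) ((v i).1.1 t)) := by
      change (evolOp p hB₀ (v i).1 - f i : Lp X p (timeMeasure a b)) t = _
      rw [e1, Pi.sub_apply, e2, ← e4, sub_apply]; abel
    rw [e5, norm_neg]
    exact (B i t - B₀ t).le_of_opNorm_le e3 _
  have he0 : Tendsto e F (𝓝 0) := by
    refine tendsto_of_seq_tendsto fun u hu => ?_
    obtain ⟨R, hR⟩ := exists_norm_le_of_weakTendsto (f := fun n => f (u n)) (g := f₀)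
      fun χ => (hf χ).comp hu
    have hdS : Tendsto (fun n => d (u n) * ‖S‖) atTop (𝓝 0) := by
      simpa using (hd.comp hu).mul_const ‖S‖
    -- From `‖e‖ ≤ |d| ‖S‖ (R + ‖e‖)`, the term in `‖e‖` is absorbed once `|d| ‖S‖ < 1/2`, whence
    -- the factor `2`.
    refine squeeze_zero_norm' (a := fun n => 2 * (|d (u n)| * ‖S‖ * R)) ?_ ?_
    · filter_upwards [hu.eventually hez, (hdS.abs).eventually (eventually_lt_nhds
        (by norm_num : |(0 : ℝ)| < 1 / 2))]
        with n h1 h2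
      rw [abs_mul, abs_of_nonneg (norm_nonneg S)] at h2
      have h3 : ‖(v (u n)).1‖ ≤ ‖S‖ * (R + ‖e (u n)‖) := by
        rw [← hS.left_inv h1.1]
        refine (S.le_opNorm _).trans (mul_le_mul_of_nonneg_left ?_ (norm_nonneg _))
        calc ‖evolOp p hB₀ (v (u n)).1‖ = ‖f (u n) + e (u n)‖ := by
              change _ = ‖f (u n) + (evolOp p hB₀ (v (u n)).1 - f (u n))‖
              rw [add_sub_cancel]
          _ ≤ _ := (norm_add_le _ _).trans (add_le_add (hR n) le_rfl)
      have h4 : ‖e (u n)‖ ≤ |d (u n)| * (‖S‖ * (R + ‖e (u n)‖)) :=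
        h1.2.trans (mul_le_mul (le_abs_self _) ((norm_fst_le _).trans h3) (norm_nonneg _)
          (abs_nonneg _))
      rw [← mul_assoc, mul_add] at h4
      have h5 : |d (u n)| * ‖S‖ * ‖e (u n)‖ ≤ 1 / 2 * ‖e (u n)‖ :=
        mul_le_mul_of_nonneg_right h2.le (norm_nonneg _)
      change ‖e (u n)‖ ≤ _
      linarith
    · have := (((hd.comp hu).abs.mul_const ‖S‖).mul_const R).const_mul 2
      simpa using this
  -- Here `φ (v i) = ψ (f i + e i)` with `ψ = φ ∘ S`: the first part converges weakly, the second in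
  -- norm.
  have hlim : Tendsto (fun i => ψ (f i) + ψ (e i)) F (𝓝 (ψ f₀ + ψ 0)) :=
    (hf ψ).add ((ψ.continuous.tendsto 0).comp he0)
  rw [map_zero, add_zero, ← hev₀, ← hψ v₀ hz₀] at hlim
  refine hlim.congr' ?_
  filter_upwards [hez] with i hi
  rw [hψ _ hi.1, ← map_add]
  change ψ (f i + (evolOp p hB₀ (v i).1 - f i)) = _
  rw [add_sub_cancel]

end Conclusion

end MaxReg

/-! ### The main theorem -/

theorem mainTheorem9
    {X D : Type*} [NormedAddCommGroup X] [NormedSpace ℝ X] [CompleteSpace X]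
    [NormedAddCommGroup D] [NormedSpace ℝ D] [CompleteSpace D]
    (j : D →L[ℝ] X) (hj_inj : Function.Injective j) (hj_dense : DenseRange j)
    (hj_compact : IsCompactOperator j)
    (p : ℝ≥0∞) [Fact (1 ≤ p)] (hp_one : 1 < p) (hp_top : p ≠ ⊤)
    (a b : ℝ) (hab : a < b)
    {Λ : Type*} [MetricSpace Λ] (O : Set Λ) (hO : IsOpen O)
    (A : Λ → ℝ → D →L[ℝ] X)
    (hA_rc : ∀ l ∈ O, MaxReg.RelCont j a b (A l))
    (hA_mr : ∀ t ∈ Icc a b, ∀ l ∈ O, MaxReg.IsMaxRegAut p j 0 ⊤ (A l t))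
    (hA_sup : ∀ t ∈ Icc a b, ⨆ l ∈ O, MaxReg.mrConst p j a b (fun _ => A l t) < ⊤)
    (l₀ : Λ) (hl₀ : l₀ ∈ closure O)
    (hA_unif : Tendsto (fun l => MaxReg.distInfty a b (A l) (A l₀)) (𝓝[O] l₀) (𝓝 0)) :
    (∀ l ∈ O, MaxReg.IsMaxReg p j a b (A l)) ∧
    MaxReg.IsMaxReg p j a b (A l₀) ∧
    (∀ t ∈ Icc a b, Tendsto (fun l => A l t) (𝓝[O] l₀) (𝓝 (A l₀ t)) →
      MaxReg.GraphNormEquiv j (A l₀ t)) ∧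
    ∀ (f : Λ → Lp X p (MaxReg.timeMeasure a b)) (v : Λ → MaxReg.MRSpace p j a b),
      MaxReg.WeakTendstoLp p a b f (𝓝[O] l₀) (f l₀) →
      (∀ l ∈ O, MaxReg.IsSolution p j a b (A l) (f l) (v l)) →
      MaxReg.IsSolution p j a b (A l₀) (f l₀) (v l₀) →
      MaxReg.WeakTendstoMR p j a b v (𝓝[O] l₀) (v l₀) := by
  have hne : (𝓝[O] l₀).NeBot := mem_closure_iff_nhdsWithin_neBot.1 hl₀
  have hmr := fun t ht l hl => (hA_mr t ht l hl).2
  have hbdd : ∀ l ∈ O, MaxReg.AEBddOp (MaxReg.timeMeasure a b) (A l) := fun l hl =>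
    (hA_rc l hl).aeBddOp
  have hfin : ∀ᶠ l in 𝓝[O] l₀, MaxReg.distInfty a b (A l) (A l₀) ≠ ⊤ :=
    (hA_unif.eventually (gt_mem_nhds ENNReal.zero_lt_top)).mono fun _ h => h.ne
  set d : Λ → ℝ := fun l => (MaxReg.distInfty a b (A l) (A l₀)).toReal
  have hd : Tendsto d (𝓝[O] l₀) (𝓝 0) := by
    have h := (ENNReal.tendsto_toReal ENNReal.zero_ne_top).comp hA_unif
    rw [ENNReal.toReal_zero] at h
    exact h
  have hdist : ∀ᶠ l in 𝓝[O] l₀, l ∈ O ∧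
      ∀ᵐ t ∂MaxReg.timeMeasure a b, ‖A l t - A l₀ t‖ ≤ d l := by
    filter_upwards [hfin, self_mem_nhdsWithin] with l h hl
    exact ⟨hl, MaxReg.ae_norm_sub_le_distInfty h⟩
  -- Measurability of the limit and convergence at almost every time need a countable family, hence
  -- a sequence of parameters; its first `N` terms are dropped to stay in `O` with finite distance.
  obtain ⟨u, hu⟩ := exists_seq_tendsto (𝓝[O] l₀)
  obtain ⟨N, hN⟩ := eventually_atTop.1 (hu.eventually hdist)
  have huN : Tendsto (fun n => u (n + N)) atTop (𝓝[O] l₀) := hu.comp (tendsto_add_atTop_nat N)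
  have huO : ∀ n, u (n + N) ∈ O := fun n => (hN _ (Nat.le_add_left N n)).1
  obtain ⟨hbdd₀, hlim₀⟩ := MaxReg.AEBddOp.of_tendsto (fun n => hbdd _ (huO n)) (hd.comp huN)
    (fun n => (hN _ (Nat.le_add_left N n)).2)
  obtain ⟨S₀, hS₀⟩ := MaxReg.exists_causalInverse_of_approx hp_top hab hA_rc hmr hA_sup hbdd₀
    (fun ε hε => by
      obtain ⟨l, h1, h2⟩ := (hdist.and (hd.eventually (gt_mem_nhds hε))).exists
      refine ⟨l, h1.1, ?_⟩
      filter_upwards [h1.2] with t ht using ht.trans h2.le)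
  obtain ⟨c, hc, hgraph⟩ := MaxReg.exists_graph_bound (j := j) hp_top hab
  refine ⟨fun l hl => ⟨(hbdd l hl).memLInfty, ?_, ?_⟩, ⟨hbdd₀.memLInfty, ?_,
    hS₀.wellPosed hp_top hab⟩, fun t ht hlim => ?_, fun f v hf hv hv₀ => ?_⟩
  · filter_upwards [MaxReg.ae_mem_timeInterval a b] with t ht
    rw [MaxReg.timeInterval_coe] at ht
    exact (hA_mr t (Ioo_subset_Icc_self ht) l hl).1
  -- The approximation result applied to `A l` itself, approximated by itself at distance zero.
  · obtain ⟨S, hS⟩ := MaxReg.exists_causalInverse_of_approx hp_top hab hA_rc hmr hA_sup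
      (hbdd l hl) (fun ε hε => ⟨l, hl, Eventually.of_forall fun t => by simpa using hε.le⟩)
    exact hS.wellPosed hp_top hab
  · filter_upwards [MaxReg.ae_mem_timeInterval a b, hlim₀] with t ht hlim
    rw [MaxReg.timeInterval_coe] at ht
    obtain ⟨K, hK⟩ := MaxReg.exists_uniform_mrBound (hA_sup t (Ioo_subset_Icc_self ht))
    exact MaxReg.GraphNormEquiv.of_tendsto hlim K.2 hc
      (Eventually.of_forall fun n => hgraph _ K (hK _ (huO n)))
  · obtain ⟨K, hK⟩ := MaxReg.exists_uniform_mrBound (hA_sup t ht)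
    refine MaxReg.GraphNormEquiv.of_tendsto hlim K.2 hc ?_
    filter_upwards [self_mem_nhdsWithin] with l hl using hgraph _ K (hK l hl)
  · exact hS₀.weakTendstoMR hp_top hab hd
      (eventually_mem_nhdsWithin.mono hbdd) (hdist.mono fun _ h => h.2) hf
      (eventually_mem_nhdsWithin.mono hv) hv₀
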